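/- Let $m,n\ge 1$ be integers, let $\theta$ be a permutation of $\{1,\dots,m\}\times\{1,\dots,n\}$, and let $\mathbb{F}_\theta^+$ be the unital semigroup generated by $e_1,\dots,e_m,f_1,\dots,f_n$ subject to the relations $e_if_j=f_{j'}e_{i'}$ whenever $\theta(i,j)=(i',j')$. The degree of a word with $k$ letters $e$ and $l$ letters $f$ is $(k,l)$. A $*$-representation of $\mathbb{F}_\theta^+$ is a unital homomorphism $\sigma$ into the bounded operators on a complex Hilbert space such that $\sigma(e_i)^*\sigma(e_k)=\delta_{ik}I$, $\sigma(f_j)^*\sigma(f_l)=\delta_{jl}I$ and $\sum_i\sigma(e_i)\sigma(e_i)^*=I=\sum_j\sigma(f_j)\sigma(f_j)^*$. Let $\mathrm{C}^*(\mathbb{F}_\theta^+)$ be the universal C*-algebra for the family of $*$-representations of $\mathbb{F}_\theta^+$. A tail is an infinite word $\tau=e_{i_0}f_{j_0}e_{i_1}f_{j_1}\cdots$. For integers $s,t\le 0$ let $i_{s,t}$ and $j_{s,t}$ be the unique indices such that for all large $T$ the word $e_{i_0}f_{j_0}\cdots e_{i_{T-1}}f_{j_{T-1}}$ factors as $w_1w_2$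 with $w_1$ of degree $(|s|,|t|)$ and $w_2=e_{i_{s,t}}w'=f_{j_{s,t}}w''$ for some words $w',w''$. The symmetry group $H_\tau$ consists of the $(p,q)\in\mathbb{Z}^2$ for which there is an integer $T$ with $T,\,T+p,\,T+q\le 0$ such that $(i_{s+p,t+q},j_{s+p,t+q})=(i_{s,t},j_{s,t})$ for all $s,t\le T$. The semigroup $\mathbb{F}_\theta^+$ is called aperiodic if there is a tail $\tau$ with $H_\tau=\{(0,0)\}$. If $\mathbb{F}_\theta^+$ is aperiodic, then $\mathrm{C}^*(\mathbb{F}_\theta^+)$ is simple, i.e. it is nonzero and its only closed two-sided ideals are $0$ and $\mathrm{C}^*(\mathbb{F}_\theta^+)$. -/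

import Mathlib

universe u

noncomputable section

open scoped ENNReal

namespace RankTwo

/-! ### The semigroup `𝔽_θ⁺` -/

section Semigroup

/-- The commutation relations `e_i f_j = f_{j'} e_{i'}` where `θ (i, j) = (i', j')`;
the letter `Sum.inl i` stands for `e_i` and the letter `Sum.inr j` for `f_j`. -/
inductive CommRel {m n : ℕ} (θ : Equiv.Perm (Fin m × Fin n)) :
    FreeMonoid (Fin m ⊕ Fin n) → FreeMonoid (Fin m ⊕ Fin n) → Prop
  | comm (i : Fin m) (j : Fin n) :
      CommRel θ (FreeMonoid.of (Sum.inl i) * FreeMonoid.of (Sum.inr j))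
        (FreeMonoid.of (Sum.inr (θ (i, j)).2) * FreeMonoid.of (Sum.inl (θ (i, j)).1))

/-- The unital semigroup `𝔽_θ⁺` generated by `e_1, …, e_m, f_1, …, f_n` subject to the
commutation relations given by `θ`. -/
abbrev FTheta {m n : ℕ} (θ : Equiv.Perm (Fin m × Fin n)) : Type :=
  PresentedMonoid (CommRel θ)

variable {m n : ℕ} {θ : Equiv.Perm (Fin m × Fin n)}

/-- The generator `e_i`. -/
def e (θ : Equiv.Perm (Fin m × Fin n)) (i : Fin m) : FTheta θ :=
  PresentedMonoid.of (CommRel θ) (Sum.inl i)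

/-- The generator `f_j`. -/
def f (θ : Equiv.Perm (Fin m × Fin n)) (j : Fin n) : FTheta θ :=
  PresentedMonoid.of (CommRel θ) (Sum.inr j)

/-- The degree of a word: `(k, l)` if it has `k` letters `e` and `l` letters `f`. -/
def degree (θ : Equiv.Perm (Fin m × Fin n)) : FTheta θ →* Multiplicative (ℕ × ℕ) :=
  PresentedMonoid.lift
    (Sum.elim (fun _ => Multiplicative.ofAdd (1, 0)) (fun _ => Multiplicative.ofAdd (0, 1)))
    (by rintro _ _ ⟨i, j⟩; rfl)

/-- `HasDegree w s t`: the word `w` has degree `(s, t)`. -/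
def HasDegree (w : FTheta θ) (s t : ℕ) : Prop :=
  degree θ w = Multiplicative.ofAdd (s, t)

/-! Unique factorization, which makes the integer data of a tail well defined. -/

theorem e_mul_f (i : Fin m) (j : Fin n) :
    e θ i * f θ j = f θ (θ (i, j)).2 * e θ (θ (i, j)).1 :=
  PresentedMonoid.mk_eq_mk_of_rel (CommRel.comm i j)

theorem f_mul_e (i : Fin m) (j : Fin n) :
    f θ j * e θ i = e θ (θ.symm (i, j)).1 * f θ (θ.symm (i, j)).2 := by
  rw [e_mul_f]; simp

theorem word_induction {P : FTheta θ → Prop} (one : P 1)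
    (he : ∀ i w, P w → P (e θ i * w)) (hf : ∀ j w, P w → P (f θ j * w)) (w : FTheta θ) : P w := by
  induction w using PresentedMonoid.inductionOn with
  | _ a =>
    induction a using FreeMonoid.inductionOn' with
    | one => exact one
    | of_mul x a ih =>
      rw [map_mul]
      cases x with
      | inl i => exact he i _ ih
      | inr j => exact hf j _ ih

theorem degree_e_mul (i : Fin m) (w : FTheta θ) :
    degree θ (e θ i * w) = Multiplicative.ofAdd (1, 0) * degree θ w := by
  rw [map_mul]; rfl

theorem degree_f_mul (j : Fin n) (w : FTheta θ) :
    degree θ (f θ j * w) = Multiplicative.ofAdd (0, 1) * degree θ w := by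
  rw [map_mul]; rfl

theorem hasDegree_e_mul {i : Fin m} {w : FTheta θ} {s t : ℕ} :
    HasDegree (e θ i * w) (s + 1) t ↔ HasDegree w s t := by
  unfold HasDegree
  rw [degree_e_mul, show (Multiplicative.ofAdd (s + 1, t) : Multiplicative (ℕ × ℕ)) =
    Multiplicative.ofAdd (1, 0) * Multiplicative.ofAdd (s, t) by
      rw [← ofAdd_add, Prod.mk_add_mk, zero_add, add_comm 1 s]]
  exact mul_right_inj _

theorem hasDegree_f_mul {j : Fin n} {w : FTheta θ} {s t : ℕ} :
    HasDegree (f θ j * w) s (t + 1) ↔ HasDegree w s t := by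
  unfold HasDegree
  rw [degree_f_mul, show (Multiplicative.ofAdd (s, t + 1) : Multiplicative (ℕ × ℕ)) =
    Multiplicative.ofAdd (0, 1) * Multiplicative.ofAdd (s, t) by
      rw [← ofAdd_add, Prod.mk_add_mk, zero_add, add_comm 1 t]]
  exact mul_right_inj _

theorem exists_hasDegree (w : FTheta θ) : ∃ s t, HasDegree w s t :=
  ⟨(Multiplicative.toAdd (degree θ w)).1, (Multiplicative.toAdd (degree θ w)).2, rfl⟩

theorem HasDegree.unique {w : FTheta θ} {s t s' t' : ℕ} (h : HasDegree w s t)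
    (h' : HasDegree w s' t') : s = s' ∧ t = t' := by
  have := h.symm.trans h'
  simpa using this

theorem HasDegree.mul {w w' : FTheta θ} {s t s' t' : ℕ} (h : HasDegree w s t)
    (h' : HasDegree w' s' t') : HasDegree (w * w') (s + s') (t + t') := by
  unfold HasDegree at *
  rw [map_mul, h, h']; rfl

theorem hasDegree_one : HasDegree (1 : FTheta θ) 0 0 := map_one _

theorem eq_one_of_hasDegree (w : FTheta θ) : HasDegree w 0 0 → w = 1 := by
  induction w using word_induction with
  | one => intro; rfl
  | he i w _ =>
    intro h
    obtain ⟨s, t, hw⟩ := exists_hasDegree w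
    have := (hasDegree_e_mul (i := i).2 hw).unique h
    omega
  | hf j w _ =>
    intro h
    obtain ⟨s, t, hw⟩ := exists_hasDegree w
    have := (hasDegree_f_mul (j := j).2 hw).unique h
    omega

theorem exists_e_mul (w : FTheta θ) :
    ∀ {s t : ℕ}, HasDegree w (s + 1) t → ∃ i w', w = e θ i * w' ∧ HasDegree w' s t := by
  induction w using word_induction with
  | one => intro s t h; have := h.unique hasDegree_one; omega
  | he i w _ => intro s t h; exact ⟨i, w, rfl, hasDegree_e_mul.1 h⟩
  | hf j w ih =>
    intro s t h
    obtain ⟨s', t', hw⟩ := exists_hasDegree w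
    obtain ⟨rfl, rfl⟩ := (hasDegree_f_mul (j := j).2 hw).unique h
    obtain ⟨i, w', rfl, hw'⟩ := ih hw
    refine ⟨(θ.symm (i, j)).1, f θ (θ.symm (i, j)).2 * w', ?_, hasDegree_f_mul.2 hw'⟩
    rw [← mul_assoc, f_mul_e, mul_assoc]

theorem exists_f_mul (w : FTheta θ) :
    ∀ {s t : ℕ}, HasDegree w s (t + 1) → ∃ j w', w = f θ j * w' ∧ HasDegree w' s t := by
  induction w using word_induction with
  | one => intro s t h; have := h.unique hasDegree_one; omega
  | hf j w _ => intro s t h; exact ⟨j, w, rfl, hasDegree_f_mul.1 h⟩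
  | he i w ih =>
    intro s t h
    obtain ⟨s', t', hw⟩ := exists_hasDegree w
    obtain ⟨rfl, rfl⟩ := (hasDegree_e_mul (i := i).2 hw).unique h
    obtain ⟨j, w', rfl, hw'⟩ := ih hw
    refine ⟨(θ (i, j)).2, e θ (θ (i, j)).1 * w', ?_, hasDegree_e_mul.2 hw'⟩
    rw [← mul_assoc, e_mul_f, mul_assoc]

theorem exists_factor (s t : ℕ) : ∀ {w : FTheta θ} {k l : ℕ}, HasDegree w (s + k) (t + l) →
    ∃ w₁ w₂, w = w₁ * w₂ ∧ HasDegree w₁ s t ∧ HasDegree w₂ k l := by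
  induction s with
  | zero =>
    induction t with
    | zero =>
      intro w k l h
      rw [zero_add, zero_add] at h
      exact ⟨1, w, (one_mul w).symm, hasDegree_one, h⟩
    | succ t ih =>
      intro w k l h
      rw [add_right_comm] at h
      obtain ⟨j, w', rfl, h'⟩ := exists_f_mul w h
      obtain ⟨w₁, w₂, rfl, h₁, h₂⟩ := ih h'
      exact ⟨f θ j * w₁, w₂, (mul_assoc _ _ _).symm, hasDegree_f_mul.2 h₁, h₂⟩
  | succ s ih =>
    intro w k l h
    rw [add_right_comm] at h
    obtain ⟨i, w', rfl, h'⟩ := exists_e_mul w h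
    obtain ⟨w₁, w₂, rfl, h₁, h₂⟩ := ih h'
    exact ⟨e θ i * w₁, w₂, (mul_assoc _ _ _).symm, hasDegree_e_mul.2 h₁, h₂⟩

/-- Moving `f_j` through `e_u`: if `push θ j u = (u', j')` then `f_j e_u = e_{u'} f_{j'}`. -/
def push (θ : Equiv.Perm (Fin m × Fin n)) : Fin n → List (Fin m) → List (Fin m) × Fin n
  | j, [] => ([], j)
  | j, i :: u =>
      ((θ.symm (i, j)).1 :: (push θ (θ.symm (i, j)).2 u).1, (push θ (θ.symm (i, j)).2 u).2)

theorem push_injective : ∀ (u u' : List (Fin m)) (j j' : Fin n),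
    push θ j u = push θ j' u' → j = j' ∧ u = u'
  | [], [], _, _, h => ⟨congrArg Prod.snd h, rfl⟩
  | [], _ :: _, _, _, h => by simp [push] at h
  | _ :: _, [], _, _, h => by simp [push] at h
  | i :: u, i' :: u', j, j', h => by
    simp only [push, Prod.mk.injEq, List.cons.injEq] at h
    obtain ⟨⟨h₁, h₂⟩, h₃⟩ := h
    obtain ⟨h₄, h₅⟩ := push_injective u u' _ _ (Prod.ext h₂ h₃)
    have h₆ : (i, j) = (i', j') := θ.symm.injective (Prod.ext h₁ h₄)
    simp only [Prod.mk.injEq] at h₆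
    exact ⟨h₆.2, by rw [h₆.1, h₅]⟩

/-- Left multiplication on normal forms `e_u f_v`. -/
def normalAct (θ : Equiv.Perm (Fin m × Fin n)) :
    FTheta θ →* Function.End (List (Fin m) × List (Fin n)) :=
  PresentedMonoid.lift (M := Function.End (List (Fin m) × List (Fin n)))
    (Sum.elim (fun i p => (i :: p.1, p.2))
      (fun j p => ((push θ j p.1).1, (push θ j p.1).2 :: p.2)))
    (by
      rintro _ _ ⟨i, j⟩
      funext p
      rw [map_mul, map_mul]
      change (i :: (push θ j p.1).1, (push θ j p.1).2 :: p.2) =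
        ((push θ (θ (i, j)).2 ((θ (i, j)).1 :: p.1)).1,
          (push θ (θ (i, j)).2 ((θ (i, j)).1 :: p.1)).2 :: p.2)
      simp [push])

theorem normalAct_e_mul (i : Fin m) (w : FTheta θ) (p : List (Fin m) × List (Fin n)) :
    normalAct θ (e θ i * w) p = (i :: (normalAct θ w p).1, (normalAct θ w p).2) := by
  rw [map_mul]; rfl

theorem normalAct_f_mul (j : Fin n) (w : FTheta θ) (p : List (Fin m) × List (Fin n)) :
    normalAct θ (f θ j * w) p = ((push θ j (normalAct θ w p).1).1,
      (push θ j (normalAct θ w p).1).2 :: (normalAct θ w p).2) := by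
  rw [map_mul]; rfl

theorem f_mul_word (u : List (Fin m)) : ∀ j : Fin n, f θ j * (u.map (e θ)).prod =
    ((push θ j u).1.map (e θ)).prod * f θ (push θ j u).2 := by
  induction u with
  | nil => intro j; simp [push]
  | cons i u ih =>
    intro j
    simp only [push, List.map_cons, List.prod_cons]
    rw [← mul_assoc, f_mul_e, mul_assoc, ih, mul_assoc]

theorem eq_normal (w : FTheta θ) : ((normalAct θ w ([], [])).1.map (e θ)).prod *
    ((normalAct θ w ([], [])).2.map (f θ)).prod = w := by
  induction w using word_induction with
  | one => rw [map_one]; simp [Function.End.one_def]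
  | he i w ih =>
    rw [normalAct_e_mul]
    simp only [List.map_cons, List.prod_cons]
    rw [mul_assoc, ih]
  | hf j w ih =>
    rw [normalAct_f_mul]
    simp only [List.map_cons, List.prod_cons]
    rw [← mul_assoc, ← f_mul_word, mul_assoc, ih]

theorem eq_of_normal_eq {w w' : FTheta θ}
    (h : normalAct θ w ([], []) = normalAct θ w' ([], [])) : w = w' := by
  rw [← eq_normal w, ← eq_normal w', h]

theorem e_mul_cancel {i i' : Fin m} {w w' : FTheta θ} (h : e θ i * w = e θ i' * w') :
    i = i' ∧ w = w' := by
  have h' := congrArg (fun x => normalAct θ x ([], [])) h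
  simp only [normalAct_e_mul, Prod.mk.injEq, List.cons.injEq] at h'
  exact ⟨h'.1.1, eq_of_normal_eq (Prod.ext h'.1.2 h'.2)⟩

theorem f_mul_cancel {j j' : Fin n} {w w' : FTheta θ} (h : f θ j * w = f θ j' * w') :
    j = j' ∧ w = w' := by
  have h' := congrArg (fun x => normalAct θ x ([], [])) h
  simp only [normalAct_f_mul, Prod.mk.injEq, List.cons.injEq] at h'
  obtain ⟨h₁, h₂⟩ := push_injective _ _ _ _ (Prod.ext h'.1 h'.2.1)
  exact ⟨h₁, eq_of_normal_eq (Prod.ext h₂ h'.2.2)⟩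

theorem factor_unique (s t : ℕ) : ∀ {w₁ w₁' w₂ w₂' : FTheta θ}, HasDegree w₁ s t →
    HasDegree w₁' s t → w₁ * w₂ = w₁' * w₂' → w₁ = w₁' ∧ w₂ = w₂' := by
  induction s with
  | zero =>
    induction t with
    | zero =>
      intro w₁ w₁' w₂ w₂' h h' hw
      obtain rfl := eq_one_of_hasDegree _ h
      obtain rfl := eq_one_of_hasDegree _ h'
      exact ⟨rfl, by simpa using hw⟩
    | succ t ih =>
      intro w₁ w₁' w₂ w₂' h h' hw
      obtain ⟨j, w, rfl, hj⟩ := exists_f_mul _ h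
      obtain ⟨j', w', rfl, hj'⟩ := exists_f_mul _ h'
      rw [mul_assoc, mul_assoc] at hw
      obtain ⟨rfl, hw'⟩ := f_mul_cancel hw
      obtain ⟨rfl, hw''⟩ := ih hj hj' hw'
      exact ⟨rfl, hw''⟩
  | succ s ih =>
    intro w₁ w₁' w₂ w₂' h h' hw
    obtain ⟨i, w, rfl, hi⟩ := exists_e_mul _ h
    obtain ⟨i', w', rfl, hi'⟩ := exists_e_mul _ h'
    rw [mul_assoc, mul_assoc] at hw
    obtain ⟨rfl, hw'⟩ := e_mul_cancel hw
    obtain ⟨rfl, hw''⟩ := ih hi hi' hw'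
    exact ⟨rfl, hw''⟩

end Semigroup

/-! ### Tails, their integer data, and aperiodicity -/

/-- A tail, i.e. an infinite word `τ = e_{i_0} f_{j_0} e_{i_1} f_{j_1} ⋯` in standard form. -/
structure Tail (m n : ℕ) where
  /-- the indices `i_0, i_1, …` -/
  i : ℕ → Fin m
  /-- the indices `j_0, j_1, …` -/
  j : ℕ → Fin n

namespace Tail

variable {m n : ℕ} (θ : Equiv.Perm (Fin m × Fin n)) (τ : Tail m n)

/-- The initial segment `τ_T = e_{i_0} f_{j_0} ⋯ e_{i_{T-1}} f_{j_{T-1}}` of degree `(T, T)`. -/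
def initial : ℕ → FTheta θ
  | 0 => 1
  | T + 1 => initial T * (e θ (τ.i T) * f θ (τ.j T))

theorem hasDegree_initial : ∀ T, HasDegree (τ.initial θ T) T T
  | 0 => hasDegree_one
  | T + 1 => (hasDegree_initial T).mul (w' := e θ (τ.i T) * f θ (τ.j T)) rfl

theorem initial_add (T k : ℕ) : ∃ r, τ.initial θ (T + k) = τ.initial θ T * r := by
  induction k with
  | zero => exact ⟨1, (mul_one _).symm⟩
  | succ k ih =>
    obtain ⟨r, hr⟩ := ih
    exact ⟨r * (e θ (τ.i (T + k)) * f θ (τ.j (T + k))), by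
      rw [← mul_assoc, ← hr]; rfl⟩

/-- `i` is the blue label at the vertex `(-s, -t)`: some initial segment of `τ` factors as
`w₁ w₂` where `w₁` has degree `(s, t)` and `w₂ = e_i w'`. -/
def IsBlueLabel (s t : ℕ) (i : Fin m) : Prop :=
  ∃ (T : ℕ) (w₁ w' : FTheta θ), HasDegree w₁ s t ∧ τ.initial θ T = w₁ * (e θ i * w')

/-- `j` is the red label at the vertex `(-s, -t)`: some initial segment of `τ` factors as
`w₁ w₂` where `w₁` has degree `(s, t)` and `w₂ = f_j w'`. -/
def IsRedLabel (s t : ℕ) (j : Fin n) : Prop :=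
  ∃ (T : ℕ) (w₁ w' : FTheta θ), HasDegree w₁ s t ∧ τ.initial θ T = w₁ * (f θ j * w')

theorem existsUnique_blueLabel (s t : ℕ) : ∃! i, τ.IsBlueLabel θ s t i := by
  have h := τ.hasDegree_initial θ (s + t + 1)
  obtain ⟨w₁, w₂, hw, h₁, h₂⟩ := exists_factor s t (k := t + 1) (l := s + 1)
    (by rwa [← add_assoc, show t + (s + 1) = s + t + 1 by omega])
  obtain ⟨i, w', rfl, -⟩ := exists_e_mul _ h₂
  refine ⟨i, ⟨_, w₁, w', h₁, hw⟩, ?_⟩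
  rintro i' ⟨T, v₁, v', hv₁, hv⟩
  obtain ⟨r, hr⟩ := τ.initial_add θ T (s + t + 1)
  obtain ⟨r', hr'⟩ := τ.initial_add θ (s + t + 1) T
  rw [hv, add_comm, hr', hw, mul_assoc, mul_assoc v₁] at hr
  have := (factor_unique s t h₁ hv₁ hr).2
  rw [mul_assoc, mul_assoc] at this
  exact (e_mul_cancel this).1.symm

theorem existsUnique_redLabel (s t : ℕ) : ∃! j, τ.IsRedLabel θ s t j := by
  have h := τ.hasDegree_initial θ (s + t + 1)
  obtain ⟨w₁, w₂, hw, h₁, h₂⟩ := exists_factor s t (k := t + 1) (l := s + 1)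
    (by rwa [← add_assoc, show t + (s + 1) = s + t + 1 by omega])
  obtain ⟨j, w', rfl, -⟩ := exists_f_mul _ h₂
  refine ⟨j, ⟨_, w₁, w', h₁, hw⟩, ?_⟩
  rintro j' ⟨T, v₁, v', hv₁, hv⟩
  obtain ⟨r, hr⟩ := τ.initial_add θ T (s + t + 1)
  obtain ⟨r', hr'⟩ := τ.initial_add θ (s + t + 1) T
  rw [hv, add_comm, hr', hw, mul_assoc, mul_assoc v₁] at hr
  have := (factor_unique s t h₁ hv₁ hr).2
  rw [mul_assoc, mul_assoc] at this
  exact (f_mul_cancel this).1.symm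

/-- The datum `i_{s,t}` of the tail `τ`, for integers `s, t ≤ 0`
(the values at other `s, t` are irrelevant). -/
def blue (s t : ℤ) : Fin m :=
  (τ.existsUnique_blueLabel θ (-s).toNat (-t).toNat).choose

/-- The datum `j_{s,t}` of the tail `τ`, for integers `s, t ≤ 0`
(the values at other `s, t` are irrelevant). -/
def red (s t : ℤ) : Fin n :=
  (τ.existsUnique_redLabel θ (-s).toNat (-t).toNat).choose

/-- The symmetry group `H_τ`: all `(p, q) ∈ ℤ²` such that, for some `T`,
`(i_{s+p,t+q}, j_{s+p,t+q}) = (i_{s,t}, j_{s,t})` for all `s, t ≤ T`.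
The bounds `T ≤ 0`, `T + p ≤ 0`, `T + q ≤ 0` keep all indices where the data are defined. -/
def symmetryGroup : Set (ℤ × ℤ) :=
  {x | ∃ T : ℤ, T ≤ 0 ∧ T + x.1 ≤ 0 ∧ T + x.2 ≤ 0 ∧ ∀ s t : ℤ, s ≤ T → t ≤ T →
    (τ.blue θ (s + x.1) (t + x.2), τ.red θ (s + x.1) (t + x.2)) = (τ.blue θ s t, τ.red θ s t)}

/-- A tail is aperiodic if its symmetry group is trivial. -/
def IsAperiodic : Prop :=
  τ.symmetryGroup θ = {(0, 0)}

end Tail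

/-- `𝔽_θ⁺` is aperiodic (satisfies the aperiodicity condition) if it has an aperiodic
infinite word. -/
def Aperiodic {m n : ℕ} (θ : Equiv.Perm (Fin m × Fin n)) : Prop :=
  ∃ τ : Tail m n, τ.IsAperiodic θ

/-! ### `*`-representations and the universal C⋆-algebra -/

/-- A `*`-representation of `𝔽_θ⁺` on a nonzero complex Hilbert space `H`: a row isometric, defect
free representation. That the row operator `[σ(e_1) ⋯ σ(e_m)]` is an isometry means that
`σ(e_i)* σ(e_k) = δ_{ik} I`, and likewise for the `f_j`. -/
structure StarRep {m n : ℕ} (θ : Equiv.Perm (Fin m × Fin n)) : Type (u + 1) where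
  /-- the Hilbert space -/
  H : Type u
  [normed : NormedAddCommGroup H]
  [inner : InnerProductSpace ℂ H]
  [complete : CompleteSpace H]
  [nontriv : Nontrivial H]
  /-- the representation -/
  σ : FTheta θ →* (H →L[ℂ] H)
  isometric_e : ∀ i k, star (σ (e θ i)) * σ (e θ k) = if i = k then 1 else 0
  isometric_f : ∀ j l, star (σ (f θ j)) * σ (f θ l) = if j = l then 1 else 0
  defectFree_e : ∑ i, σ (e θ i) * star (σ (e θ i)) = 1
  defectFree_f : ∑ j, σ (f θ j) * star (σ (f θ j)) = 1

attribute [instance] StarRep.normed StarRep.inner StarRep.complete StarRep.nontriv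

section Universal

variable {m n : ℕ} (θ : Equiv.Perm (Fin m × Fin n))

theorem StarRep.norm_le_one {θ : Equiv.Perm (Fin m × Fin n)} (ρ : StarRep.{u} θ) (w : FTheta θ) :
    ‖ρ.σ w‖ ≤ 1 := by
  have key : ∀ a b : ρ.H →L[ℂ] ρ.H, star a * a = 1 → ‖b‖ ≤ 1 → ‖a * b‖ ≤ 1 := by
    intro a b ha hb
    have h := CStarRing.norm_star_mul_self (x := a)
    rw [ha, norm_one] at h
    have h1 : ‖a‖ ≤ 1 := by nlinarith [norm_nonneg a]
    calc ‖a * b‖ ≤ ‖a‖ * ‖b‖ := norm_mul_le _ _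
      _ ≤ 1 := mul_le_one₀ h1 (norm_nonneg _) hb
  induction w using word_induction with
  | one => simp
  | he i w ih => rw [map_mul]; exact key _ _ (by simpa using ρ.isometric_e i i) ih
  | hf j w ih => rw [map_mul]; exact key _ _ (by simpa using ρ.isometric_f j j) ih

/-- The C⋆-algebra of all bounded families of operators, one on the Hilbert space of each
`*`-representation of `𝔽_θ⁺`. -/
abbrev BoundedFamilies : Type (u + 1) :=
  lp (fun ρ : StarRep.{u} θ => ρ.H →L[ℂ] ρ.H) ∞

instance : CStarAlgebra (BoundedFamilies.{u} θ) where

/-- The image of a word in the direct sum of all `*`-representations: the family `(σ(w))_σ`. -/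
def universalFamily (w : FTheta θ) : BoundedFamilies.{u} θ :=
  ⟨fun ρ => ρ.σ w, memℓp_infty ⟨1, by rintro _ ⟨ρ, rfl⟩; exact ρ.norm_le_one w⟩⟩

/-- `C*(𝔽_θ⁺)`, the universal C⋆-algebra for the family of `*`-representations of `𝔽_θ⁺`: the
C⋆-algebra generated by the image of `𝔽_θ⁺` under the direct sum of all its
`*`-representations, so that the norm of a polynomial in the generators and their adjoints is
the supremum of its norms in all `*`-representations. -/
def universalSubalgebra : StarSubalgebra ℂ (BoundedFamilies.{u} θ) :=
  (StarAlgebra.adjoin ℂ (Set.range (universalFamily.{u} θ))).topologicalClosure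

/-- The type underlying `C*(𝔽_θ⁺)`. -/
abbrev CStarFTheta : Type (u + 1) := universalSubalgebra.{u} θ

instance : CStarAlgebra (CStarFTheta.{u} θ) :=
  StarSubalgebra.cstarAlgebra _ (h_closed := StarSubalgebra.isClosed_topologicalClosure _)

end Universal

/-- A C⋆-algebra is simple if it is nonzero and has no closed two-sided ideals other than `0` and
itself. -/
def IsSimpleCStarAlgebra (A : Type*) [CStarAlgebra A] : Prop :=
  Nontrivial A ∧ ∀ I : TwoSidedIdeal A, IsClosed (I : Set A) → I = ⊥ ∨ I = ⊤

end RankTwo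

end

open scoped ENNReal
open MeasureTheory

namespace RankTwo


/-! ### Word combinatorics and the calculus of the elements `u v*` -/

section Words

variable {m n : ℕ} {θ : Equiv.Perm (Fin m × Fin n)}

/-! Averaging over the gauge action of the 2-torus gives a faithful positive map, and aperiodicity
controls this average inside any proper ideal. Let `I` be a proper ideal, `a ∈ I` and `b = a* a`.
The claim is that for every representation `ρ` and vector `ξ` the function `z ↦ ⟨ξ, ρ_z(b) ξ⟩` on
the torus has integral `0`, where `ρ_z` is the gauge twist of `ρ`. Since the function is continuous
and nonnegative it then vanishes at `z = 1`, so `ρ(a) ξ = 0`; hence `a = 0`.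

For the claim, approximate `b` by a finite sum `x` of multiples of `u v*` with all degrees at most
`(k, k)`. Integration kills the terms with `deg u ≠ deg v`; the others refine to combinations of `p
q*` with `p, q` of degree `(k, k)`, so the average of `x` is governed by a finite matrix `C`
(`integral_inner_evalGauge_sum`).

Aperiodicity supplies a word `S` such that words of distinct small degrees get orthogonal ranges
after right multiplication by `S` (`Tail.IsAperiodic.exists_separating`). Compressing `x` by `∑ α_p
pS` therefore gives exactly the scalar `α* C α` (`IsStarRep.compress`). The same compression of `b`
lies in `I`, and a scalar `z` is at distance at least `|z|` from a proper ideal, so `|α* C α| ≤ ‖x -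
b‖ ‖α‖²` (`IsStarRep.norm_sum_invariantCoeff_le`). Thus the average of `x` is small, and so is that
of `b`.

The algebra is nonzero because the semigroup acts on the basis of `ℓ²` of its infinite paths
(`nonempty_starRep`). -/

theorem finite_setOf_hasDegree (s t : ℕ) : {w : FTheta θ | HasDegree w s t}.Finite := by
  induction s with
  | zero =>
    induction t with
    | zero => exact (Set.finite_singleton 1).subset fun w hw => eq_one_of_hasDegree w hw
    | succ t ih =>
      refine (Set.finite_iUnion fun j => ih.image (f θ j * ·)).subset fun w hw => ?_
      obtain ⟨j, w', rfl, h'⟩ := exists_f_mul w hw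
      exact Set.mem_iUnion.2 ⟨j, w', h', rfl⟩
  | succ s ih =>
    refine (Set.finite_iUnion fun i => ih.image (e θ i * ·)).subset fun w hw => ?_
    obtain ⟨i, w', rfl, h'⟩ := exists_e_mul w hw
    exact Set.mem_iUnion.2 ⟨i, w', h', rfl⟩

/-- The finite set of words of degree `(s, t)`. -/
noncomputable def words (θ : Equiv.Perm (Fin m × Fin n)) (s t : ℕ) : Finset (FTheta θ) :=
  (finite_setOf_hasDegree s t).toFinset

@[simp]
theorem mem_words {s t : ℕ} {w : FTheta θ} : w ∈ words θ s t ↔ HasDegree w s t := by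
  simp [words]

theorem words_zero_zero : words θ 0 0 = {1} := by
  ext w
  simp only [mem_words, Finset.mem_singleton]
  exact ⟨eq_one_of_hasDegree w, by rintro rfl; exact hasDegree_one⟩

theorem sum_words_succ_left {M : Type*} [AddCommMonoid M] (s t : ℕ) (F : FTheta θ → M) :
    ∑ w ∈ words θ (s + 1) t, F w = ∑ i, ∑ w ∈ words θ s t, F (e θ i * w) := by
  rw [← Finset.sum_product']
  symm
  refine Finset.sum_bij (fun p _ => e θ p.1 * p.2) ?_ ?_ ?_ fun _ _ => rfl
  · intro p hp
    simpa [hasDegree_e_mul] using hp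
  · intro p _ q _ h
    exact Prod.ext (e_mul_cancel h).1 (e_mul_cancel h).2
  · intro w hw
    obtain ⟨i, w', rfl, h'⟩ := exists_e_mul w (mem_words.1 hw)
    exact ⟨(i, w'), by simpa using h', rfl⟩

theorem sum_words_succ_right {M : Type*} [AddCommMonoid M] (s t : ℕ) (F : FTheta θ → M) :
    ∑ w ∈ words θ s (t + 1), F w = ∑ j, ∑ w ∈ words θ s t, F (f θ j * w) := by
  rw [← Finset.sum_product']
  symm
  refine Finset.sum_bij (fun p _ => f θ p.1 * p.2) ?_ ?_ ?_ fun _ _ => rfl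
  · intro p hp
    simpa [hasDegree_f_mul] using hp
  · intro p _ q _ h
    exact Prod.ext (f_mul_cancel h).1 (f_mul_cancel h).2
  · intro w hw
    obtain ⟨j, w', rfl, h'⟩ := exists_f_mul w (mem_words.1 hw)
    exact ⟨(j, w'), by simpa using h', rfl⟩

theorem mul_left_cancel_word {w a b : FTheta θ} (h : w * a = w * b) : a = b := by
  obtain ⟨s, t, hw⟩ := exists_hasDegree w
  exact (factor_unique s t hw hw h).2

theorem HasDegree.of_mul {w w' : FTheta θ} {s t k l : ℕ} (h : HasDegree w s t)
    (h' : HasDegree (w * w') k l) : s ≤ k ∧ t ≤ l ∧ HasDegree w' (k - s) (l - t) := by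
  obtain ⟨s', t', hw'⟩ := exists_hasDegree w'
  obtain ⟨rfl, rfl⟩ := h'.unique (h.mul hw')
  refine ⟨by omega, by omega, ?_⟩
  simpa using hw'

/-- An abstract `*`-representation: the images of the generators form two Cuntz families. -/
structure IsStarRep {R : Type*} [Ring R] [StarRing R] (g : FTheta θ →* R) : Prop where
  isometric_e : ∀ i k, star (g (e θ i)) * g (e θ k) = if i = k then 1 else 0
  isometric_f : ∀ j l, star (g (f θ j)) * g (f θ l) = if j = l then 1 else 0
  defectFree_e : ∑ i, g (e θ i) * star (g (e θ i)) = 1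
  defectFree_f : ∑ j, g (f θ j) * star (g (f θ j)) = 1

namespace IsStarRep

variable {R : Type*} [Ring R] [StarRing R] {g : FTheta θ →* R} (hg : IsStarRep g)

include hg

theorem star_mul_self (w : FTheta θ) : star (g w) * g w = 1 := by
  induction w using word_induction with
  | one => simp
  | he i w ih =>
    rw [map_mul, star_mul, mul_assoc, ← mul_assoc (star (g (e θ i))), hg.isometric_e]
    simpa using ih
  | hf j w ih =>
    rw [map_mul, star_mul, mul_assoc, ← mul_assoc (star (g (f θ j))), hg.isometric_f]
    simpa using ih

theorem star_mul_mul (w r : FTheta θ) : star (g w) * g (w * r) = g r := by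
  rw [map_mul, ← mul_assoc, hg.star_mul_self, one_mul]

theorem star_mul_of_mul (w r : FTheta θ) : star (g (w * r)) * g w = star (g r) := by
  rw [map_mul, star_mul, mul_assoc, hg.star_mul_self, mul_one]

theorem star_mul_eq_zero (s t : ℕ) : ∀ {w w' : FTheta θ}, HasDegree w s t → HasDegree w' s t →
    w ≠ w' → star (g w) * g w' = 0 := by
  induction s with
  | zero =>
    induction t with
    | zero =>
      intro w w' h h' hne
      exact absurd ((eq_one_of_hasDegree w h).trans (eq_one_of_hasDegree w' h').symm) hne
    | succ t ih =>
      intro w w' h h' hne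
      obtain ⟨j, w, rfl, hw⟩ := exists_f_mul w h
      obtain ⟨l, w', rfl, hw'⟩ := exists_f_mul w' h'
      rw [map_mul, map_mul, star_mul, mul_assoc, ← mul_assoc (star (g (f θ j))), hg.isometric_f]
      split_ifs with hjl
      · subst hjl
        rw [one_mul]
        exact ih hw hw' fun h => hne (by rw [h])
      · simp
  | succ s ih =>
    intro w w' h h' hne
    obtain ⟨j, w, rfl, hw⟩ := exists_e_mul w h
    obtain ⟨l, w', rfl, hw'⟩ := exists_e_mul w' h'
    rw [map_mul, map_mul, star_mul, mul_assoc, ← mul_assoc (star (g (e θ j))), hg.isometric_e]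
    split_ifs with hjl
    · subst hjl
      rw [one_mul]
      exact ih hw hw' fun h => hne (by rw [h])
    · simp

theorem sum_words (s t : ℕ) : ∑ w ∈ words θ s t, g w * star (g w) = 1 := by
  induction s with
  | zero =>
    induction t with
    | zero => simp [words_zero_zero]
    | succ t ih =>
      rw [sum_words_succ_right, ← hg.defectFree_f]
      refine Finset.sum_congr rfl fun j _ => ?_
      calc ∑ w ∈ words θ 0 t, g (f θ j * w) * star (g (f θ j * w))
          = g (f θ j) * (∑ w ∈ words θ 0 t, g w * star (g w)) * star (g (f θ j)) := by
            rw [Finset.mul_sum, Finset.sum_mul]; simp [mul_assoc]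
        _ = _ := by rw [ih, mul_one]
  | succ s ih =>
    rw [sum_words_succ_left, ← hg.defectFree_e]
    refine Finset.sum_congr rfl fun j _ => ?_
    calc ∑ w ∈ words θ s t, g (e θ j * w) * star (g (e θ j * w))
        = g (e θ j) * (∑ w ∈ words θ s t, g w * star (g w)) * star (g (e θ j)) := by
          rw [Finset.mul_sum, Finset.sum_mul]; simp [mul_assoc]
      _ = _ := by rw [ih, mul_one]

/-- By unique factorization `p` has a prefix of the degree of `w`. If it is not `w`, the two ranges
are orthogonal. -/
theorem star_mul_eq_zero_of_le {w p : FTheta θ} {s t k l : ℕ} (hw : HasDegree w s t)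
    (hp : HasDegree p k l) (hs : s ≤ k) (ht : t ≤ l) (h : ∀ r, p ≠ w * r) :
    star (g w) * g p = 0 := by
  obtain ⟨w', r, rfl, hw', -⟩ := exists_factor s t (k := k - s) (l := l - t) (w := p)
    (by rwa [Nat.add_sub_cancel' hs, Nat.add_sub_cancel' ht])
  rw [map_mul, ← mul_assoc, hg.star_mul_eq_zero s t hw hw' (by rintro rfl; exact h r rfl),
    zero_mul]

theorem star_mul_eq_zero_of_le' {w p : FTheta θ} {s t k l : ℕ} (hw : HasDegree w s t)
    (hp : HasDegree p k l) (hs : s ≤ k) (ht : t ≤ l) (h : ∀ r, p ≠ w * r) :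
    star (g p) * g w = 0 := by
  simpa using congrArg star (hg.star_mul_eq_zero_of_le hw hp hs ht h)

theorem star_mul_eq_sum (v p : FTheta θ) (s t : ℕ) :
    star (g v) * g p = ∑ w ∈ words θ s t, (star (g v) * g w) * (star (g w) * g p) := by
  conv_lhs => rw [← one_mul (g p), ← hg.sum_words s t, Finset.sum_mul, Finset.mul_sum]
  simp [mul_assoc]

/-- Insert `∑ w w* = 1` over a degree dominating both words: a summand survives only if `w` extends
both `v` and `p`. -/
theorem star_mul_eq_zero_of_forall_ne {v p : FTheta θ} (h : ∀ r s, v * r ≠ p * s) :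
    star (g v) * g p = 0 := by
  obtain ⟨s, t, hv⟩ := exists_hasDegree v
  obtain ⟨s', t', hp⟩ := exists_hasDegree p
  rw [hg.star_mul_eq_sum v p (s + s') (t + t')]
  refine Finset.sum_eq_zero fun w hw => ?_
  rw [mem_words] at hw
  by_cases h₁ : ∃ r, w = v * r
  · obtain ⟨r, rfl⟩ := h₁
    rw [hg.star_mul_eq_zero_of_le' hp hw (by omega) (by omega) (h r), mul_zero]
  · push Not at h₁
    rw [hg.star_mul_eq_zero_of_le hv hw (by omega) (by omega) h₁, zero_mul]

/-- In the same expansion a surviving `w = v r = p r'` contributes `r r'*`. -/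
theorem star_mul_mem_span [Algebra ℂ R] (v p : FTheta θ) :
    star (g v) * g p ∈
      Submodule.span ℂ (Set.range fun x : FTheta θ × FTheta θ => g x.1 * star (g x.2)) := by
  obtain ⟨s, t, hv⟩ := exists_hasDegree v
  obtain ⟨s', t', hp⟩ := exists_hasDegree p
  rw [hg.star_mul_eq_sum v p (s + s') (t + t')]
  refine Submodule.sum_mem _ fun w hw => ?_
  rw [mem_words] at hw
  by_cases h₁ : ∃ r, w = v * r
  · by_cases h₂ : ∃ r, w = p * r
    · obtain ⟨r, hr⟩ := h₁
      obtain ⟨r', hr'⟩ := h₂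
      refine Submodule.subset_span ⟨(r, r'), ?_⟩
      conv_rhs => rw [hr, hg.star_mul_mul, ← hr, hr', hg.star_mul_of_mul]
    · push Not at h₂
      rw [hg.star_mul_eq_zero_of_le' hp hw (by omega) (by omega) h₂, mul_zero]
      exact zero_mem _
  · push Not at h₁
    rw [hg.star_mul_eq_zero_of_le hv hw (by omega) (by omega) h₁, zero_mul]
    exact zero_mem _

/-- The span of the `u v*` is closed under products, because the middle factor `v* p` of `(u v*)(p
q*)` is again in the span. -/
theorem adjoin_le_span [Algebra ℂ R] [StarModule ℂ R] {x : R}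
    (hx : x ∈ StarAlgebra.adjoin ℂ (Set.range g)) :
    x ∈ Submodule.span ℂ (Set.range fun x : FTheta θ × FTheta θ => g x.1 * star (g x.2)) := by
  set V := Submodule.span ℂ (Set.range fun x : FTheta θ × FTheta θ => g x.1 * star (g x.2))
  have key : ∀ (u q : FTheta θ), ∀ y ∈ V, g u * y * star (g q) ∈ V := by
    intro u q y hy
    induction hy using Submodule.span_induction with
    | mem y hy =>
      obtain ⟨⟨a, b⟩, rfl⟩ := hy
      exact Submodule.subset_span ⟨(u * a, q * b), by simp [mul_assoc]⟩
    | zero => simp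
    | add y z _ _ hy hz => rw [mul_add, add_mul]; exact add_mem hy hz
    | smul c y _ hy => simpa using V.smul_mem c hy
  induction hx using StarAlgebra.adjoin_induction with
  | mem x hx =>
    obtain ⟨w, rfl⟩ := hx
    exact Submodule.subset_span ⟨(w, 1), by simp⟩
  | algebraMap r =>
    rw [Algebra.algebraMap_eq_smul_one]
    exact V.smul_mem _ (Submodule.subset_span ⟨(1, 1), by simp⟩)
  | add x y _ _ hx hy => exact add_mem hx hy
  | mul x y hx' hy' hx hy =>
    clear hx' hy'
    induction hx using Submodule.span_induction with
    | mem x hx =>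
      obtain ⟨⟨u, v⟩, rfl⟩ := hx
      induction hy using Submodule.span_induction with
      | mem y hy =>
        obtain ⟨⟨p, q⟩, rfl⟩ := hy
        have := key u q _ (hg.star_mul_mem_span v p)
        simpa [mul_assoc] using this
      | zero => simp
      | add y z _ _ hy hz => rw [mul_add]; exact add_mem hy hz
      | smul c y _ hy => simpa using V.smul_mem c hy
    | zero => simp
    | add y z _ _ hy hz => rw [add_mul]; exact add_mem hy hz
    | smul c y _ hy => simpa using V.smul_mem c hy
  | star x hx' hx =>
    clear hx'
    induction hx using Submodule.span_induction with
    | mem x hx =>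
      obtain ⟨⟨u, v⟩, rfl⟩ := hx
      exact Submodule.subset_span ⟨(v, u), by simp⟩
    | zero => simp
    | add y z _ _ hy hz => rw [star_add]; exact add_mem hy hz
    | smul c y _ hy => rw [star_smul]; exact V.smul_mem _ hy

open scoped Classical in
/-- For words `u`, `v` of the same degree, refine `u v*` to words of degree `(k, k)`. -/
theorem mul_star_eq_sum {u v : FTheta θ} {s t k : ℕ} (hu : HasDegree u s t)
    (hv : HasDegree v s t) (hs : s ≤ k) (ht : t ≤ k) :
    g u * star (g v) = ∑ p ∈ words θ k k, ∑ q ∈ words θ k k,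
      if ∃ r, p = u * r ∧ q = v * r then g p * star (g q) else 0 := by
  -- Insert `∑ r r* = 1` over the complementary degree between `u` and `v*`.
  have h1 : g u * star (g v) =
      ∑ r ∈ words θ (k - s) (k - t), g (u * r) * star (g (v * r)) := by
    conv_lhs => rw [← mul_one (g u), ← hg.sum_words (k - s) (k - t), Finset.mul_sum,
      Finset.sum_mul]
    simp [mul_assoc]
  rw [h1, ← Finset.sum_product', ← Finset.sum_filter]
  refine Finset.sum_bij (fun r _ => (u * r, v * r)) ?_ ?_ ?_ fun _ _ => rfl
  · intro r hr
    rw [mem_words] at hr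
    have h2 := hu.mul hr
    have h3 := hv.mul hr
    rw [Nat.add_sub_cancel' hs, Nat.add_sub_cancel' ht] at h2 h3
    simp only [Finset.mem_filter, Finset.mem_product, mem_words]
    exact ⟨⟨h2, h3⟩, r, rfl, rfl⟩
  · intro r _ r' _ h
    exact mul_left_cancel_word (congrArg Prod.fst h)
  · rintro ⟨p, q⟩ h
    simp only [Finset.mem_filter, Finset.mem_product, mem_words] at h
    obtain ⟨⟨hp, hq⟩, r, rfl, rfl⟩ := h
    exact ⟨r, mem_words.2 (hu.of_mul hp).2.2, rfl⟩

open scoped Classical in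
/-- If words of distinct degrees at most `(k, k)` acquire orthogonal ranges after right
multiplication by `S`, then compression by words of degree `(k, k)` followed by `S` turns the
elements `u v*` into scalars. -/
theorem compress {S : FTheta θ} {k : ℕ}
    (hS : ∀ (a b : FTheta θ) (s t s' t' : ℕ), HasDegree a s t → HasDegree b s' t' →
      s ≤ k → t ≤ k → s' ≤ k → t' ≤ k → (s, t) ≠ (s', t') → ∀ r r', a * S * r ≠ b * S * r')
    {u v p q : FTheta θ} {s t s' t' : ℕ} (hu : HasDegree u s t) (hv : HasDegree v s' t')
    (hs : s ≤ k) (ht : t ≤ k) (hs' : s' ≤ k) (ht' : t' ≤ k)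
    (hp : HasDegree p k k) (hq : HasDegree q k k) :
    star (g (p * S)) * (g u * star (g v)) * g (q * S) =
      if ∃ r, p = u * r ∧ q = v * r then 1 else 0 := by
  have h1 : star (g (p * S)) * (g u * star (g v)) * g (q * S) =
      star (g S) * (star (g p) * g u) * (star (g v) * g q) * g S := by
    simp [mul_assoc]
  rw [h1]
  by_cases hpu : ∃ r, p = u * r
  swap
  · rw [if_neg (by rintro ⟨r, h, -⟩; exact hpu ⟨r, h⟩),
      hg.star_mul_eq_zero_of_le' hu hp hs ht (by simpa using hpu)]
    simp
  by_cases hqv : ∃ r, q = v * r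
  swap
  · rw [if_neg (by rintro ⟨r, -, h⟩; exact hqv ⟨r, h⟩),
      hg.star_mul_eq_zero_of_le hv hq hs' ht' (by simpa using hqv)]
    simp
  obtain ⟨a, rfl⟩ := hpu
  obtain ⟨b, rfl⟩ := hqv
  obtain ⟨-, -, ha⟩ := hu.of_mul hp
  obtain ⟨-, -, hb⟩ := hv.of_mul hq
  rw [hg.star_mul_of_mul, hg.star_mul_mul]
  have h2 : star (g S) * star (g a) * g b * g S = star (g (a * S)) * g (b * S) := by
    simp [mul_assoc]
  rw [h2]
  by_cases hab : a = b
  · subst hab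
    rw [if_pos ⟨a, rfl, rfl⟩, hg.star_mul_self]
  · rw [if_neg]
    -- If `u` and `v` have equal degrees, so do `a` and `b`, and distinct words of equal degree are
    -- orthogonal without help from `S`. Otherwise the complementary degrees in `(k, k)` differ and
    -- `S` separates `a` from `b`.
    · by_cases hd : (s, t) = (s', t')
      · obtain ⟨rfl, rfl⟩ := Prod.mk.inj hd
        rw [← h2, mul_assoc (star (g S)), hg.star_mul_eq_zero _ _ ha hb hab]
        simp
      · refine hg.star_mul_eq_zero_of_forall_ne (hS a b _ _ _ _ ha hb (by omega) (by omega)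
          (by omega) (by omega) fun h => hd ?_)
        simp only [Prod.mk.injEq] at h ⊢
        omega
    · rintro ⟨r, h₁, h₂⟩
      exact hab ((mul_left_cancel_word h₁).trans (mul_left_cancel_word h₂).symm)

end IsStarRep

end Words

/-! ### From aperiodicity to a separating word -/

section Aperiodic

variable {m n : ℕ} {θ : Equiv.Perm (Fin m × Fin n)} {τ : Tail m n}

/-- A label is defined through some initial segment; uniqueness makes it visible in every segment
that reaches past its vertex. -/
theorem Tail.exists_blueLabel_factor (τ : Tail m n) {s t T : ℕ} (hs : s < T) (ht : t < T) :
    ∃ w₁ w', HasDegree w₁ s t ∧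
      τ.initial θ T = w₁ * (e θ (τ.blue θ (-s) (-t)) * w') := by
  have h := τ.hasDegree_initial θ T
  obtain ⟨k, rfl⟩ := Nat.exists_eq_add_of_lt hs
  obtain ⟨l, hl⟩ := Nat.exists_eq_add_of_lt ht
  obtain ⟨w₁, w₂, hw, h₁, h₂⟩ := exists_factor s t (k := k + 1) (l := l + 1)
    (by rw [← add_assoc, ← add_assoc, ← hl]; exact h)
  obtain ⟨i, w', rfl, -⟩ := exists_e_mul _ h₂
  have hi : τ.IsBlueLabel θ s t i := ⟨_, w₁, w', h₁, hw⟩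
  have := (τ.existsUnique_blueLabel θ (- -(s : ℤ)).toNat (- -(t : ℤ)).toNat).choose_spec.2 i
    (by simpa using hi)
  rw [this] at hw
  exact ⟨w₁, w', h₁, hw⟩

theorem Tail.exists_redLabel_factor (τ : Tail m n) {s t T : ℕ} (hs : s < T) (ht : t < T) :
    ∃ w₁ w', HasDegree w₁ s t ∧
      τ.initial θ T = w₁ * (f θ (τ.red θ (-s) (-t)) * w') := by
  have h := τ.hasDegree_initial θ T
  obtain ⟨k, rfl⟩ := Nat.exists_eq_add_of_lt hs
  obtain ⟨l, hl⟩ := Nat.exists_eq_add_of_lt ht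
  obtain ⟨w₁, w₂, hw, h₁, h₂⟩ := exists_factor s t (k := k + 1) (l := l + 1)
    (by rw [← add_assoc, ← add_assoc, ← hl]; exact h)
  obtain ⟨i, w', rfl, -⟩ := exists_f_mul _ h₂
  have hi : τ.IsRedLabel θ s t i := ⟨_, w₁, w', h₁, hw⟩
  have := (τ.existsUnique_redLabel θ (- -(s : ℤ)).toNat (- -(t : ℤ)).toNat).choose_spec.2 i
    (by simpa using hi)
  rw [this] at hw
  exact ⟨w₁, w', h₁, hw⟩

/-- If `a τ = b τ` as infinite words, then the difference of the degrees of `a` and `b` is a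
symmetry of `τ`. -/
theorem Tail.degree_sub_mem_symmetryGroup {a b : FTheta θ} {s t s' t' : ℕ}
    (ha : HasDegree a s t) (hb : HasDegree b s' t')
    (h : ∀ T, ∃ r r', a * τ.initial θ T * r = b * τ.initial θ T * r') :
    ((s' : ℤ) - s, (t' : ℤ) - t) ∈ τ.symmetryGroup θ := by
  -- This bound is low enough that the shifted indices stay nonpositive.
  refine ⟨-(s + t + s' + t' : ℤ), by omega, by dsimp only; omega, by dsimp only; omega, ?_⟩
  intro x y hx hy
  obtain ⟨x₁, hx₁⟩ : ∃ x₁ : ℕ, x = -(x₁ : ℤ) := ⟨(-x).toNat, by omega⟩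
  obtain ⟨y₁, hy₁⟩ : ∃ y₁ : ℕ, y = -(y₁ : ℤ) := ⟨(-y).toNat, by omega⟩
  obtain ⟨x₂, hx₂⟩ : ∃ x₂ : ℕ, x + (s' - s) = -(x₂ : ℤ) := ⟨(-(x + (s' - s))).toNat, by omega⟩
  obtain ⟨y₂, hy₂⟩ : ∃ y₂ : ℕ, y + (t' - t) = -(y₂ : ℤ) := ⟨(-(y + (t' - t))).toNat, by omega⟩
  dsimp only
  rw [hx₂, hy₂, hx₁, hy₁]
  -- The prefix of `a τ` ending at vertex `(x₁, y₁)` of `τ` and that of `b τ` ending at `(x₂, y₂)`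
  -- have the same degree, so unique factorization forces the next letters to agree.
  have hxx : s' + x₂ = s + x₁ := by omega
  have hyy : t' + y₂ = t + y₁ := by omega
  obtain ⟨r, r', hr⟩ := h (x₁ + y₁ + x₂ + y₂ + 1)
  refine Prod.ext ?_ ?_
  · obtain ⟨w₁, w', hw₁, hw⟩ := τ.exists_blueLabel_factor (θ := θ)
      (show x₁ < x₁ + y₁ + x₂ + y₂ + 1 by omega) (show y₁ < x₁ + y₁ + x₂ + y₂ + 1 by omega)
    obtain ⟨v₁, v', hv₁, hv⟩ := τ.exists_blueLabel_factor (θ := θ)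
      (show x₂ < x₁ + y₁ + x₂ + y₂ + 1 by omega) (show y₂ < x₁ + y₁ + x₂ + y₂ + 1 by omega)
    have hr' : a * w₁ * (e θ (τ.blue θ (-x₁) (-y₁)) * (w' * r)) =
        b * v₁ * (e θ (τ.blue θ (-x₂) (-y₂)) * (v' * r')) := by
      conv_lhs at hr => rw [hw]
      conv_rhs at hr => rw [hv]
      simpa only [mul_assoc] using hr
    have hd := hb.mul hv₁
    rw [hxx, hyy] at hd
    exact (e_mul_cancel (factor_unique _ _ (ha.mul hw₁) hd hr').2).1.symm
  · obtain ⟨w₁, w', hw₁, hw⟩ := τ.exists_redLabel_factor (θ := θ)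
      (show x₁ < x₁ + y₁ + x₂ + y₂ + 1 by omega) (show y₁ < x₁ + y₁ + x₂ + y₂ + 1 by omega)
    obtain ⟨v₁, v', hv₁, hv⟩ := τ.exists_redLabel_factor (θ := θ)
      (show x₂ < x₁ + y₁ + x₂ + y₂ + 1 by omega) (show y₂ < x₁ + y₁ + x₂ + y₂ + 1 by omega)
    have hr' : a * w₁ * (f θ (τ.red θ (-x₁) (-y₁)) * (w' * r)) =
        b * v₁ * (f θ (τ.red θ (-x₂) (-y₂)) * (v' * r')) := by
      conv_lhs at hr => rw [hw]
      conv_rhs at hr => rw [hv]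
      simpa only [mul_assoc] using hr
    have hd := hb.mul hv₁
    rw [hxx, hyy] at hd
    exact (f_mul_cancel (factor_unique _ _ (ha.mul hw₁) hd hr').2).1.symm

/-- For each pair of words of distinct degrees, `a τ = b τ` would give a nonzero symmetry, so some
initial segment of `τ` already tells them apart, and so does every longer one. Only finitely many
pairs occur, so one segment serves them all. -/
theorem Tail.IsAperiodic.exists_separating (hτ : τ.IsAperiodic θ) (k : ℕ) :
    ∃ S : FTheta θ, ∀ (a b : FTheta θ) (s t s' t' : ℕ), HasDegree a s t → HasDegree b s' t' →
      s ≤ k → t ≤ k → s' ≤ k → t' ≤ k → (s, t) ≠ (s', t') →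
      ∀ r r', a * S * r ≠ b * S * r' := by
  have hfin : {w : FTheta θ | ∃ s t, s ≤ k ∧ t ≤ k ∧ HasDegree w s t}.Finite := by
    refine ((Set.finite_Iic k).biUnion fun s _ => (Set.finite_Iic k).biUnion fun t _ =>
      finite_setOf_hasDegree (θ := θ) s t).subset ?_
    rintro w ⟨s, t, hs, ht, hw⟩
    simp only [Set.mem_iUnion]
    exact ⟨s, hs, t, ht, hw⟩
  have hev : ∀ᶠ T in Filter.atTop, ∀ x ∈ {w : FTheta θ | ∃ s t, s ≤ k ∧ t ≤ k ∧ HasDegree w s t} ×ˢ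
      {w : FTheta θ | ∃ s t, s ≤ k ∧ t ≤ k ∧ HasDegree w s t}, degree θ x.1 ≠ degree θ x.2 →
      ∀ r r', x.1 * τ.initial θ T * r ≠ x.2 * τ.initial θ T * r' := by
    rw [Filter.eventually_all_finite (hfin.prod hfin)]
    rintro ⟨a, b⟩ -
    by_cases hab : degree θ a = degree θ b
    · exact Filter.Eventually.of_forall fun T h => absurd hab h
    obtain ⟨s, t, ha⟩ := exists_hasDegree a
    obtain ⟨s', t', hb⟩ := exists_hasDegree b
    have : ¬ ∀ T, ∃ r r', a * τ.initial θ T * r = b * τ.initial θ T * r' := by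
      intro h
      have h1 := Tail.degree_sub_mem_symmetryGroup ha hb h
      rw [hτ, Set.mem_singleton_iff, Prod.mk.injEq] at h1
      apply hab
      rw [ha, hb, show s = s' by omega, show t = t' by omega]
    push Not at this
    obtain ⟨T₀, hT₀⟩ := this
    filter_upwards [Filter.eventually_ge_atTop T₀] with T hT _ r r' h
    obtain ⟨l, rfl⟩ := Nat.exists_eq_add_of_le hT
    obtain ⟨y, hy⟩ := τ.initial_add θ T₀ l
    rw [hy] at h
    exact hT₀ (y * r) (y * r') (by simpa only [mul_assoc] using h)
  obtain ⟨T, hT⟩ := hev.exists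
  refine ⟨τ.initial θ T, fun a b s t s' t' ha hb hs ht hs' ht' hne => ?_⟩
  refine hT (a, b) ⟨⟨s, t, hs, ht, ha⟩, ⟨s', t', hs', ht', hb⟩⟩ fun h => hne ?_
  rw [ha, hb] at h
  exact h

end Aperiodic


/-! ### The gauge action and evaluation at representations -/

section Gauge

variable {m n : ℕ} {θ : Equiv.Perm (Fin m × Fin n)}

/-- The character `w ↦ z₁ ^ s z₂ ^ t`, for `w` of degree `(s, t)`. -/
noncomputable def gaugeCharacter (z : Circle × Circle) : FTheta θ →* Circle :=
  MonoidHom.comp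
    { toFun := fun d => z.1 ^ (Multiplicative.toAdd d).1 * z.2 ^ (Multiplicative.toAdd d).2
      map_one' := by simp
      map_mul' := fun d d' => by simp [pow_add, mul_mul_mul_comm] } (degree θ)

theorem gaugeCharacter_apply (z : Circle × Circle) {w : FTheta θ} {s t : ℕ}
    (h : HasDegree w s t) : gaugeCharacter z w = z.1 ^ s * z.2 ^ t := by
  change z.1 ^ (Multiplicative.toAdd (degree θ w)).1 * z.2 ^ (Multiplicative.toAdd (degree θ w)).2
    = _
  rw [h]; rfl

theorem StarRep.isStarRep (ρ : StarRep.{u} θ) : IsStarRep ρ.σ :=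
  ⟨ρ.isometric_e, ρ.isometric_f, ρ.defectFree_e, ρ.defectFree_f⟩

theorem smul_mul_star_smul {H : Type*} [NormedAddCommGroup H] [InnerProductSpace ℂ H]
    [CompleteSpace H] (z w : Circle) (a b : H →L[ℂ] H) :
    ((z : ℂ) • a) * star ((w : ℂ) • b) = ((z / w : Circle) : ℂ) • (a * star b) := by
  rw [star_smul, smul_mul_smul_comm, div_eq_mul_inv, Circle.coe_mul, Circle.coe_inv_eq_conj]
  rfl

theorem star_smul_mul_smul {H : Type*} [NormedAddCommGroup H] [InnerProductSpace ℂ H]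
    [CompleteSpace H] (z w : Circle) (a b : H →L[ℂ] H) :
    star ((z : ℂ) • a) * ((w : ℂ) • b) = ((w / z : Circle) : ℂ) • (star a * b) := by
  rw [star_smul, smul_mul_smul_comm, div_eq_mul_inv, Circle.coe_mul, Circle.coe_inv_eq_conj,
    mul_comm]
  rfl

/-- The twist of a `*`-representation by a gauge character. -/
noncomputable def StarRep.gauge (ρ : StarRep.{u} θ) (z : Circle × Circle) : StarRep.{u} θ where
  H := ρ.H
  σ :=
    { toFun := fun w => (gaugeCharacter z w : ℂ) • ρ.σ w
      map_one' := by simp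
      map_mul' := fun w w' => by
        rw [map_mul, map_mul, smul_mul_smul_comm, Circle.coe_mul] }
  isometric_e i k := by
    change star ((gaugeCharacter z _ : ℂ) • ρ.σ _) * ((gaugeCharacter z _ : ℂ) • ρ.σ _) = _
    rw [star_smul_mul_smul, ρ.isometric_e]
    split_ifs with h
    · simp [h]
    · simp
  isometric_f i k := by
    change star ((gaugeCharacter z _ : ℂ) • ρ.σ _) * ((gaugeCharacter z _ : ℂ) • ρ.σ _) = _
    rw [star_smul_mul_smul, ρ.isometric_f]
    split_ifs with h
    · simp [h]
    · simp
  defectFree_e := by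
    change ∑ i, ((gaugeCharacter z _ : ℂ) • ρ.σ _) * star ((gaugeCharacter z _ : ℂ) • ρ.σ _) = _
    simp only [smul_mul_star_smul]
    simpa using ρ.defectFree_e
  defectFree_f := by
    change ∑ i, ((gaugeCharacter z _ : ℂ) • ρ.σ _) * star ((gaugeCharacter z _ : ℂ) • ρ.σ _) = _
    simp only [smul_mul_star_smul]
    simpa using ρ.defectFree_f

/-- The value at a `*`-representation of an element of the universal C⋆-algebra. -/
noncomputable def evalRep (ρ : StarRep.{u} θ) : CStarFTheta.{u} θ →⋆ₐ[ℂ] (ρ.H →L[ℂ] ρ.H) where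
  toFun x := x.1 ρ
  map_one' := rfl
  map_mul' _ _ := rfl
  map_zero' := rfl
  map_add' _ _ := rfl
  commutes' _ := rfl
  map_star' _ := rfl

theorem evalRep_ext {x y : CStarFTheta.{u} θ} (h : ∀ ρ, evalRep ρ x = evalRep ρ y) : x = y :=
  Subtype.ext (lp.ext (funext h))

theorem norm_evalRep_le (ρ : StarRep.{u} θ) (x : CStarFTheta.{u} θ) : ‖evalRep ρ x‖ ≤ ‖x‖ :=
  lp.norm_apply_le_norm ENNReal.top_ne_zero x.1 ρ

/-- The image of a word in the universal C⋆-algebra. -/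
noncomputable def universalWord (θ : Equiv.Perm (Fin m × Fin n)) :
    FTheta θ →* CStarFTheta.{u} θ where
  toFun w := ⟨universalFamily θ w, StarSubalgebra.le_topologicalClosure _
    (StarAlgebra.subset_adjoin _ _ ⟨w, rfl⟩)⟩
  map_one' := evalRep_ext fun ρ => ρ.σ.map_one
  map_mul' w w' := evalRep_ext fun ρ => ρ.σ.map_mul w w'

theorem evalRep_universalWord (ρ : StarRep.{u} θ) (w : FTheta θ) :
    evalRep ρ (universalWord θ w) = ρ.σ w := rfl

theorem isStarRep_universalWord (θ : Equiv.Perm (Fin m × Fin n)) :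
    IsStarRep (universalWord.{u} θ) where
  isometric_e i k := evalRep_ext fun ρ => by
    rw [map_mul, map_star, evalRep_universalWord, evalRep_universalWord, ρ.isometric_e]
    split_ifs <;> simp
  isometric_f i k := evalRep_ext fun ρ => by
    rw [map_mul, map_star, evalRep_universalWord, evalRep_universalWord, ρ.isometric_f]
    split_ifs <;> simp
  defectFree_e := evalRep_ext fun ρ => by
    simp only [map_sum, map_mul, map_star, evalRep_universalWord, ρ.defectFree_e, map_one]
  defectFree_f := evalRep_ext fun ρ => by
    simp only [map_sum, map_mul, map_star, evalRep_universalWord, ρ.defectFree_f, map_one]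

/-- The homomorphism `w ↦ (σ(w))_σ` into the bounded families. -/
noncomputable def universalFamilyHom (θ : Equiv.Perm (Fin m × Fin n)) :
    FTheta θ →* BoundedFamilies.{u} θ where
  toFun := universalFamily θ
  map_one' := lp.ext (funext fun ρ => ρ.σ.map_one)
  map_mul' w w' := lp.ext (funext fun ρ => ρ.σ.map_mul w w')

/-- The relations are needed in the ambient algebra too, where the dense `StarAlgebra.adjoin` lives.
-/
theorem isStarRep_universalFamilyHom (θ : Equiv.Perm (Fin m × Fin n)) :
    IsStarRep (universalFamilyHom.{u} θ) where
  isometric_e i k := by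
    have := congrArg Subtype.val ((isStarRep_universalWord.{u} θ).isometric_e i k)
    split_ifs at this ⊢ <;> exact this
  isometric_f i k := by
    have := congrArg Subtype.val ((isStarRep_universalWord.{u} θ).isometric_f i k)
    split_ifs at this ⊢ <;> exact this
  defectFree_e := by
    have := congrArg Subtype.val (isStarRep_universalWord.{u} θ).defectFree_e
    rw [AddSubmonoidClass.coe_finsetSum] at this
    exact this
  defectFree_f := by
    have := congrArg Subtype.val (isStarRep_universalWord.{u} θ).defectFree_f
    rw [AddSubmonoidClass.coe_finsetSum] at this
    exact this

/-- The linear combinations of the elements `u v*` are dense. -/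
theorem exists_finsupp_norm_sub_lt (x : CStarFTheta.{u} θ) {ε : ℝ} (hε : 0 < ε) :
    ∃ c : FTheta θ × FTheta θ →₀ ℂ,
      ‖(∑ p ∈ c.support, c p • (universalWord θ p.1 * star (universalWord θ p.2))) - x‖ < ε := by
  obtain ⟨y, hy, hxy⟩ := Metric.mem_closure_iff.1 x.2 ε hε
  have hspan := (isStarRep_universalFamilyHom.{u} θ).adjoin_le_span (x := y) hy
  obtain ⟨c, hc⟩ := Finsupp.mem_span_range_iff_exists_finsupp.1 hspan
  refine ⟨c, ?_⟩
  have h : ((∑ p ∈ c.support, c p • (universalWord θ p.1 * star (universalWord θ p.2)) :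
      CStarFTheta.{u} θ) : BoundedFamilies.{u} θ) = y := by
    rw [← hc, AddSubmonoidClass.coe_finsetSum]
    rfl
  have h2 : ‖((∑ p ∈ c.support, c p • (universalWord θ p.1 * star (universalWord θ p.2)) :
      CStarFTheta.{u} θ) : BoundedFamilies.{u} θ) - x.1‖ < ε := by
    rw [h, ← dist_eq_norm, dist_comm]
    exact hxy
  exact h2

theorem evalRep_gauge (ρ : StarRep.{u} θ) (z : Circle × Circle) (u v : FTheta θ) :
    evalRep (ρ.gauge z) (universalWord θ u * star (universalWord θ v)) =
      (((gaugeCharacter z u / gaugeCharacter z v : Circle) : ℂ) •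
        evalRep ρ (universalWord θ u * star (universalWord θ v)) : ρ.H →L[ℂ] ρ.H) := by
  rw [map_mul, map_mul, map_star, map_star]
  exact smul_mul_star_smul _ _ _ _

theorem exists_circle_zpow_ne_one {a : ℤ} (ha : a ≠ 0) : ∃ z : Circle, z ^ a ≠ 1 := by
  -- The `a`-th power of this point is `-1`.
  refine ⟨Circle.exp (Real.pi / a), fun h => ?_⟩
  have h1 : Circle.exp Real.pi = 1 := by
    rw [← h, ← Circle.exp_zsmul]
    congr 1
    rw [zsmul_eq_mul]
    field_simp
  have h2 := congrArg (fun z : Circle => (z : ℂ)) h1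
  simp [Circle.coe_exp] at h2
  norm_num at h2

/-- The integrand is a nontrivial character; by translation invariance its integral is fixed under
multiplication by a value other than `1`. -/
theorem integral_gaugeCharacter_div_eq_zero [MeasurableSpace (Circle × Circle)]
    [BorelSpace (Circle × Circle)] (μ : Measure (Circle × Circle)) [μ.IsHaarMeasure]
    {u v : FTheta θ} {s t s' t' : ℕ} (hu : HasDegree u s t) (hv : HasDegree v s' t')
    (h : (s, t) ≠ (s', t')) :
    ∫ z, ((gaugeCharacter z u / gaugeCharacter z v : Circle) : ℂ) ∂μ = 0 := by
  have hmul : ∀ z w : Circle × Circle, gaugeCharacter (z * w) u / gaugeCharacter (z * w) v =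
      (gaugeCharacter z u / gaugeCharacter z v) * (gaugeCharacter w u / gaugeCharacter w v) := by
    intro z w
    simp only [gaugeCharacter_apply _ hu, gaugeCharacter_apply _ hv, Prod.fst_mul, Prod.snd_mul,
      mul_pow]
    rw [div_mul_div_comm]
    congr 1 <;> exact mul_mul_mul_comm _ _ _ _
  obtain ⟨z, hz⟩ : ∃ z : Circle × Circle, gaugeCharacter z u / gaugeCharacter z v ≠ 1 := by
    simp only [gaugeCharacter_apply _ hu, gaugeCharacter_apply _ hv]
    by_cases hs : s = s'
    · have ht : (t : ℤ) - t' ≠ 0 := fun h' => h (by rw [hs, show t = t' by omega])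
      obtain ⟨z, hz⟩ := exists_circle_zpow_ne_one ht
      refine ⟨(1, z), ?_⟩
      rw [zpow_sub, zpow_natCast, zpow_natCast, ← div_eq_mul_inv] at hz
      simpa using hz
    · obtain ⟨z, hz⟩ := exists_circle_zpow_ne_one (show (s : ℤ) - s' ≠ 0 by omega)
      refine ⟨(z, 1), ?_⟩
      rw [zpow_sub, zpow_natCast, zpow_natCast, ← div_eq_mul_inv] at hz
      simpa using hz
  have h1 := integral_mul_left_eq_self (μ := μ)
    (fun z => ((gaugeCharacter z u / gaugeCharacter z v : Circle) : ℂ)) z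
  simp only [hmul, Circle.coe_mul] at h1
  rw [integral_const_mul] at h1
  have h2 : (((gaugeCharacter z u / gaugeCharacter z v : Circle) : ℂ) - 1) *
    ∫ z, ((gaugeCharacter z u / gaugeCharacter z v : Circle) : ℂ) ∂μ = 0 := by
    rw [sub_mul, one_mul, h1, sub_self]
  refine (mul_eq_zero.1 h2).resolve_left fun h3 => hz ?_
  exact Circle.ext (by simpa using sub_eq_zero.1 h3)

theorem continuous_gaugeCharacter_div (u v : FTheta θ) :
    Continuous fun z : Circle × Circle =>
      ((gaugeCharacter z u / gaugeCharacter z v : Circle) : ℂ) := by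
  obtain ⟨s, t, hu⟩ := exists_hasDegree u
  obtain ⟨s', t', hv⟩ := exists_hasDegree v
  simp only [gaugeCharacter_apply _ hu, gaugeCharacter_apply _ hv]
  simp only [div_eq_mul_inv]
  exact continuous_induced_dom.comp (by fun_prop)

end Gauge


/-! ### Compression to scalars modulo a proper ideal -/

section Compression

variable {m n : ℕ} {θ : Equiv.Perm (Fin m × Fin n)}

/-- Otherwise `z⁻¹ b` is within distance `1` of the identity, hence invertible by the Neumann
series, and the ideal contains a unit. -/
theorem norm_le_norm_smul_one_sub_of_mem {A : Type*} [NormedRing A] [NormOneClass A]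
    [NormedAlgebra ℂ A] [CompleteSpace A]
    {I : TwoSidedIdeal A} (hI : I ≠ ⊤) {b : A} (hb : b ∈ I) (z : ℂ) :
    ‖z‖ ≤ ‖z • (1 : A) - b‖ := by
  by_contra! h
  have hz : z ≠ 0 := by
    rintro rfl
    rw [norm_zero] at h
    exact absurd h (not_lt.2 (norm_nonneg _))
  have h1 : ‖1 - z⁻¹ • b‖ < 1 := by
    have : z • (1 : A) - b = z • (1 - z⁻¹ • b) := by rw [smul_sub, smul_inv_smul₀ hz]
    rw [this, norm_smul] at h
    have := norm_pos_iff.2 hz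
    nlinarith
  have h2 : (Units.oneSub _ h1 : A) = z⁻¹ • b := by simp
  refine hI (I.one_mem_iff.1 ?_)
  have h3 : (1 : A) = ((Units.oneSub _ h1)⁻¹ * z⁻¹ • (1 : A)) * b := by
    have h4 := Units.inv_mul (Units.oneSub _ h1)
    rw [h2] at h4
    rw [mul_assoc, smul_mul_assoc, one_mul, h4]
  rw [h3]
  exact I.mul_mem_left _ _ hb

open scoped Classical in
/-- The coefficient at `p q*` of the gauge invariant part of `∑ c (u, v) u v*`. -/
noncomputable def invariantCoeff (c : FTheta θ × FTheta θ →₀ ℂ) (p q : FTheta θ) : ℂ :=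
  ∑ x ∈ c.support, c x * if ∃ r, p = x.1 * r ∧ q = x.2 * r then 1 else 0

/-- Bounds the numerical range of the gauge-invariant part by the distance to an element of the
ideal: the compression by `a = ∑ α_p pS` is scalar on the sum, stays in `I` on `b`, and has norm at
most `‖a‖²`. -/
theorem IsStarRep.norm_sum_invariantCoeff_le {A : Type*} [CStarAlgebra A] [Nontrivial A]
    {g : FTheta θ →* A} (hg : IsStarRep g) (hθ : Aperiodic θ) {I : TwoSidedIdeal A} (hI : I ≠ ⊤)
    {b : A} (hb : b ∈ I) {c : FTheta θ × FTheta θ →₀ ℂ} {k : ℕ}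
    (hk : ∀ x ∈ c.support, ∃ s t s' t', HasDegree x.1 s t ∧ HasDegree x.2 s' t' ∧
      s ≤ k ∧ t ≤ k ∧ s' ≤ k ∧ t' ≤ k) (α : FTheta θ → ℂ) :
    ‖∑ p ∈ words θ k k, ∑ q ∈ words θ k k, star (α p) * α q * invariantCoeff c p q‖ ≤
      ‖∑ x ∈ c.support, c x • (g x.1 * star (g x.2)) - b‖ *
        ∑ p ∈ words θ k k, ‖α p‖ ^ 2 := by
  obtain ⟨τ, hτ⟩ := hθ
  obtain ⟨S, hS⟩ := hτ.exists_separating k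
  set a : A := ∑ p ∈ words θ k k, α p • g (p * S) with ha
  have hsa : star a = ∑ p ∈ words θ k k, star (α p) • star (g (p * S)) := by
    rw [ha, star_sum]
    simp
  have hexp : ∀ y : A, star a * y * a = ∑ p ∈ words θ k k, ∑ q ∈ words θ k k,
      (star (α p) * α q) • (star (g (p * S)) * y * g (q * S)) := by
    intro y
    rw [hsa, ha, Finset.sum_mul, Finset.sum_mul]
    refine Finset.sum_congr rfl fun p _ => ?_
    rw [Finset.mul_sum]
    refine Finset.sum_congr rfl fun q _ => ?_
    rw [smul_mul_assoc, smul_mul_smul_comm]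
  -- The `pS` are isometries with orthogonal ranges, so `a* a` is a scalar.
  have hnorm : ‖a‖ * ‖a‖ = ∑ p ∈ words θ k k, ‖α p‖ ^ 2 := by
    have h1 : star a * a = ((∑ p ∈ words θ k k, ‖α p‖ ^ 2 : ℝ) : ℂ) • (1 : A) := by
      have := hexp 1
      rw [mul_one] at this
      rw [this, Complex.ofReal_sum, Finset.sum_smul]
      refine Finset.sum_congr rfl fun p hp => ?_
      rw [Finset.sum_eq_single_of_mem p hp]
      · rw [mul_one, hg.star_mul_self, Complex.ofReal_pow, ← Complex.conj_mul']
        rfl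
      · intro q hq hqp
        have h2 : star (g (p * S)) * 1 * g (q * S) =
            star (g S) * (star (g p) * g q) * g S := by simp [mul_assoc]
        rw [h2, hg.star_mul_eq_zero k k (mem_words.1 hp) (mem_words.1 hq) hqp.symm]
        simp
    rw [← CStarRing.norm_star_mul_self, h1, norm_smul, norm_one, mul_one, Complex.norm_real,
      Real.norm_of_nonneg (Finset.sum_nonneg fun _ _ => by positivity)]
  have hcomp : star a * (∑ x ∈ c.support, c x • (g x.1 * star (g x.2))) * a =
      (∑ p ∈ words θ k k, ∑ q ∈ words θ k k, star (α p) * α q * invariantCoeff c p q) •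
        (1 : A) := by
    rw [hexp, Finset.sum_smul]
    refine Finset.sum_congr rfl fun p hp => ?_
    rw [Finset.sum_smul]
    refine Finset.sum_congr rfl fun q hq => ?_
    rw [mul_smul (star (α p) * α q)]
    congr 1
    rw [invariantCoeff, Finset.sum_smul, Finset.mul_sum, Finset.sum_mul]
    refine Finset.sum_congr rfl fun x hx => ?_
    obtain ⟨s, t, s', t', hu, hv, hs, ht, hs', ht'⟩ := hk x hx
    rw [mul_smul_comm, smul_mul_assoc, hg.compress hS hu hv hs ht hs' ht' (mem_words.1 hp)
      (mem_words.1 hq), mul_smul]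
    split_ifs <;> simp
  have hmem : star a * b * a ∈ I := I.mul_mem_right _ _ (I.mul_mem_left _ _ hb)
  refine (norm_le_norm_smul_one_sub_of_mem hI hmem _).trans ?_
  rw [← hcomp, ← sub_mul, ← mul_sub, ← hnorm]
  calc _ ≤ ‖star a‖ * ‖∑ x ∈ c.support, c x • (g x.1 * star (g x.2)) - b‖ * ‖a‖ :=
        (norm_mul_le _ _).trans (mul_le_mul_of_nonneg_right (norm_mul_le _ _) (norm_nonneg _))
    _ = _ := by rw [norm_star]; ring

/-- A bound on the numerical range of a matrix extends to vector coefficients. -/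
theorem norm_sum_mul_inner_le {ι H : Type*} [NormedAddCommGroup H] [InnerProductSpace ℂ H]
    (W : Finset ι) (C : ι → ι → ℂ) (D : ℝ)
    (hC : ∀ α : ι → ℂ, ‖∑ p ∈ W, ∑ q ∈ W, star (α p) * α q * C p q‖ ≤ D * ∑ p ∈ W, ‖α p‖ ^ 2)
    (ξ : ι → H) :
    ‖∑ p ∈ W, ∑ q ∈ W, C p q * inner ℂ (ξ p) (ξ q)‖ ≤ D * ∑ p ∈ W, ‖ξ p‖ ^ 2 := by
  classical
  let K : Submodule ℂ H := Submodule.span ℂ (W.image ξ : Set H)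
  have : FiniteDimensional ℂ K := FiniteDimensional.span_finset ℂ _
  let B := stdOrthonormalBasis ℂ K
  -- The default `0` is never taken on `W`.
  let η : ι → K := fun p => if h : ξ p ∈ K then ⟨ξ p, h⟩ else 0
  have hη : ∀ p ∈ W, (η p : H) = ξ p := by
    intro p hp
    have : ξ p ∈ K := Submodule.subset_span (by simpa using ⟨p, hp, rfl⟩)
    simp [η, this]
  -- By Parseval each basis vector gives one scalar instance of `hC`, and these add up.
  have h1 : ∀ p ∈ W, ∀ q ∈ W, inner ℂ (ξ p) (ξ q) =
      ∑ i, star (inner ℂ (B i) (η p)) * inner ℂ (B i) (η q) := by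
    intro p hp q hq
    rw [← hη p hp, ← hη q hq, ← Submodule.coe_inner, ← B.sum_inner_mul_inner]
    refine Finset.sum_congr rfl fun i _ => ?_
    rw [← inner_conj_symm]
    rfl
  have h2 : ∑ p ∈ W, ∑ q ∈ W, C p q * inner ℂ (ξ p) (ξ q) = ∑ i, ∑ p ∈ W, ∑ q ∈ W,
      star (inner ℂ (B i) (η p)) * inner ℂ (B i) (η q) * C p q := by
    symm
    rw [Finset.sum_comm]
    refine Finset.sum_congr rfl fun p hp => ?_
    rw [Finset.sum_comm]
    refine Finset.sum_congr rfl fun q hq => ?_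
    rw [h1 p hp q hq, Finset.mul_sum]
    exact Finset.sum_congr rfl fun i _ => mul_comm _ _
  have h3 : ∑ p ∈ W, ‖ξ p‖ ^ 2 = ∑ i, ∑ p ∈ W, ‖(inner ℂ (B i) (η p) : ℂ)‖ ^ 2 := by
    symm
    rw [Finset.sum_comm]
    refine Finset.sum_congr rfl fun p hp => ?_
    rw [B.sum_sq_norm_inner_right, ← hη p hp]
    rfl
  rw [h2, h3, Finset.mul_sum]
  exact (norm_sum_le _ _).trans (Finset.sum_le_sum fun i _ => hC _)

end Compression

/-! ### Averaging over the torus and vanishing of proper ideals -/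

section Integration

variable {m n : ℕ} {θ : Equiv.Perm (Fin m × Fin n)}

theorem StarRep.gauge_one (ρ : StarRep.{u} θ) : ρ.gauge 1 = ρ := by
  have h : ∀ w : FTheta θ, gaugeCharacter (1 : Circle × Circle) w = 1 := by
    intro w
    obtain ⟨s, t, hw⟩ := exists_hasDegree w
    simp [gaugeCharacter_apply _ hw]
  cases ρ
  simp only [StarRep.gauge, StarRep.mk.injEq, heq_eq_eq, true_and]
  ext w
  simp [h]

/-- Evaluation at the gauge twists of a `*`-representation, on its fixed Hilbert space. -/
noncomputable def evalGauge (ρ : StarRep.{u} θ) (z : Circle × Circle) :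
    CStarFTheta.{u} θ →⋆ₐ[ℂ] (ρ.H →L[ℂ] ρ.H) :=
  evalRep (ρ.gauge z)

theorem norm_evalGauge_le (ρ : StarRep.{u} θ) (z : Circle × Circle) (x : CStarFTheta.{u} θ) :
    ‖evalGauge ρ z x‖ ≤ ‖x‖ :=
  norm_evalRep_le (ρ.gauge z) x

theorem evalGauge_mul_star (ρ : StarRep.{u} θ) (z : Circle × Circle) (u v : FTheta θ) :
    evalGauge ρ z (universalWord θ u * star (universalWord θ v)) =
      ((gaugeCharacter z u / gaugeCharacter z v : Circle) : ℂ) • (ρ.σ u * star (ρ.σ v)) :=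
  (evalRep_gauge ρ z u v).trans (by rw [map_mul, map_star]; rfl)

theorem norm_inner_evalGauge_le (ρ : StarRep.{u} θ) (z : Circle × Circle)
    (x : CStarFTheta.{u} θ) (ξ : ρ.H) : ‖inner ℂ ξ (evalGauge ρ z x ξ)‖ ≤ ‖x‖ * ‖ξ‖ ^ 2 := by
  have h1 := norm_inner_le_norm (𝕜 := ℂ) ξ (evalGauge ρ z x ξ)
  have h2 := (evalGauge ρ z x).le_of_opNorm_le (norm_evalGauge_le ρ z x) ξ
  have := norm_nonneg ξ
  nlinarith

theorem inner_evalGauge_sum (ρ : StarRep.{u} θ) (z : Circle × Circle)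
    (c : FTheta θ × FTheta θ →₀ ℂ) (ξ : ρ.H) :
    inner ℂ ξ (evalGauge ρ z
      (∑ x ∈ c.support, c x • (universalWord θ x.1 * star (universalWord θ x.2))) ξ) =
    ∑ x ∈ c.support, c x * (inner ℂ ξ ((ρ.σ x.1 * star (ρ.σ x.2)) ξ) *
      ((gaugeCharacter z x.1 / gaugeCharacter z x.2 : Circle) : ℂ)) := by
  simp only [map_sum, map_smul, evalGauge_mul_star]
  rw [sum_apply, inner_sum]
  refine Finset.sum_congr rfl fun x _ => ?_
  rw [smul_apply, smul_apply, inner_smul_right,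
    inner_smul_right]
  ring

/-- The function is a uniform limit of trigonometric polynomials, by density of the combinations of
`u v*`. -/
theorem continuous_inner_evalGauge (ρ : StarRep.{u} θ) (x : CStarFTheta.{u} θ) (ξ : ρ.H) :
    Continuous fun z => inner ℂ ξ (evalGauge ρ z x ξ) := by
  refine continuous_of_uniform_approx_of_continuous fun V hV => ?_
  obtain ⟨ε, hε, hεV⟩ := Metric.mem_uniformity_dist.1 hV
  obtain ⟨c, hc⟩ := exists_finsupp_norm_sub_lt x
    -- The `+ 1` covers `ξ = 0`.
    (show 0 < ε / (‖ξ‖ ^ 2 + 1) by positivity)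
  refine ⟨fun z => inner ℂ ξ (evalGauge ρ z
    (∑ x ∈ c.support, c x • (universalWord θ x.1 * star (universalWord θ x.2))) ξ), ?_,
    fun z => hεV ?_⟩
  · simp only [inner_evalGauge_sum]
    exact continuous_finsetSum _ fun y _ => continuous_const.mul
      (continuous_const.mul (continuous_gaugeCharacter_div _ _))
  · rw [dist_comm, dist_eq_norm, ← inner_sub_right, ← sub_apply, ← map_sub]
    refine (norm_inner_evalGauge_le _ _ _ _).trans_lt ?_
    rw [lt_div_iff₀ (by positivity)] at hc
    have := norm_nonneg ((∑ p ∈ c.support, c p • (universalWord θ p.1 * star (universalWord θ p.2))) - x)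
    by_cases h0 : ‖ξ‖ = 0
    · rw [h0]; simpa using hε
    · nlinarith

/-- Terms with `deg u ≠ deg v` integrate to zero; the rest are constant in `z` and are refined to
degree `(k, k)`. The total mass appears because the Haar measure is not normalized. -/
theorem integral_inner_evalGauge_sum [MeasurableSpace (Circle × Circle)]
    [BorelSpace (Circle × Circle)] (μ : Measure (Circle × Circle)) [μ.IsHaarMeasure]
    (ρ : StarRep.{u} θ) {c : FTheta θ × FTheta θ →₀ ℂ} {k : ℕ}
    (hk : ∀ x ∈ c.support, ∃ s t s' t', HasDegree x.1 s t ∧ HasDegree x.2 s' t' ∧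
      s ≤ k ∧ t ≤ k ∧ s' ≤ k ∧ t' ≤ k) (ξ : ρ.H) :
    ∫ z, inner ℂ ξ (evalGauge ρ z
      (∑ x ∈ c.support, c x • (universalWord θ x.1 * star (universalWord θ x.2))) ξ) ∂μ =
    μ.real Set.univ * ∑ p ∈ words θ k k, ∑ q ∈ words θ k k,
      invariantCoeff c p q * inner ℂ (star (ρ.σ p) ξ) (star (ρ.σ q) ξ) := by
  classical
  have hstar : ∀ u v : FTheta θ, inner ℂ ξ ((ρ.σ u * star (ρ.σ v)) ξ) =
      inner ℂ (star (ρ.σ u) ξ) (star (ρ.σ v) ξ) := fun u v => by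
    rw [ContinuousLinearMap.star_eq_adjoint (ρ.σ u), ContinuousLinearMap.adjoint_inner_left]
    rfl
  simp only [inner_evalGauge_sum, invariantCoeff]
  rw [integral_finsetSum]
  swap
  · intro x _
    exact (continuous_const.mul (continuous_const.mul
      (continuous_gaugeCharacter_div _ _))).integrable_of_hasCompactSupport
      (HasCompactSupport.of_compactSpace _)
  have hswap : ∑ p ∈ words θ k k, ∑ q ∈ words θ k k,
      (∑ x ∈ c.support, c x * if ∃ r, p = x.1 * r ∧ q = x.2 * r then 1 else 0) *
        inner ℂ (star (ρ.σ p) ξ) (star (ρ.σ q) ξ) =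
      ∑ x ∈ c.support, c x * ∑ p ∈ words θ k k, ∑ q ∈ words θ k k,
        (if ∃ r, p = x.1 * r ∧ q = x.2 * r then 1 else 0) *
          inner ℂ (star (ρ.σ p) ξ) (star (ρ.σ q) ξ) := by
    simp only [Finset.mul_sum, Finset.sum_mul, mul_assoc]
    symm
    rw [Finset.sum_comm]
    refine Finset.sum_congr rfl fun p _ => ?_
    rw [Finset.sum_comm]
  rw [hswap, Finset.mul_sum]
  refine Finset.sum_congr rfl fun x hx => ?_
  obtain ⟨s, t, s', t', hu, hv, hs, ht, hs', ht'⟩ := hk x hx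
  rw [integral_const_mul, integral_const_mul, mul_left_comm _ (c x)]
  congr 1
  by_cases hd : (s, t) = (s', t')
  · obtain ⟨rfl, rfl⟩ := Prod.mk.inj hd
    have h1 : ∀ z : Circle × Circle, gaugeCharacter z x.1 / gaugeCharacter z x.2 = 1 := by
      intro z
      rw [gaugeCharacter_apply _ hu, gaugeCharacter_apply _ hv, div_self']
    simp only [h1, Circle.coe_one, integral_const, mul_one, Complex.real_smul]
    rw [mul_comm, ρ.isStarRep.mul_star_eq_sum hu hv hs ht, sum_apply,
      inner_sum]
    congr 1
    refine Finset.sum_congr rfl fun p _ => ?_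
    rw [sum_apply, inner_sum]
    refine Finset.sum_congr rfl fun q _ => ?_
    split_ifs
    · rw [hstar, one_mul]
    · simp
  -- The right side vanishes too: `p = u r` and `q = v r` of equal degree would force `deg u = deg
  -- v`.
  · rw [integral_gaugeCharacter_div_eq_zero μ hu hv hd, mul_zero, eq_comm]
    convert mul_zero _
    refine Finset.sum_eq_zero fun p hp => Finset.sum_eq_zero fun q hq => ?_
    rw [if_neg, zero_mul]
    rintro ⟨r, h₁, h₂⟩
    rw [mem_words] at hp hq
    rw [h₁] at hp
    rw [h₂] at hq
    obtain ⟨-, -, h₃⟩ := hu.of_mul hp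
    obtain ⟨-, -, h₄⟩ := hv.of_mul hq
    have := h₃.unique h₄
    apply hd
    rw [Prod.mk.injEq]
    omega

/-- Apply `∑ p p* = 1` to `ξ` and pair with `ξ`. -/
theorem sum_norm_sq_star (ρ : StarRep.{u} θ) (k : ℕ) (ξ : ρ.H) :
    ∑ p ∈ words θ k k, ‖star (ρ.σ p) ξ‖ ^ 2 = ‖ξ‖ ^ 2 := by
  have h := congrArg (fun T : ρ.H →L[ℂ] ρ.H => inner ℂ ξ (T ξ)) (ρ.isStarRep.sum_words k k)
  simp only [sum_apply, inner_sum, one_apply_eq_self] at h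
  have h2 : ∀ p : FTheta θ, inner ℂ ξ ((ρ.σ p * star (ρ.σ p)) ξ) =
      ((‖star (ρ.σ p) ξ‖ ^ 2 : ℝ) : ℂ) := fun p => by
    rw [mul_apply_eq_comp, ← ContinuousLinearMap.adjoint_inner_left,
      ← ContinuousLinearMap.star_eq_adjoint, inner_self_eq_norm_sq_to_K]
    simp
  simp only [h2, inner_self_eq_norm_sq_to_K] at h
  exact Complex.ofReal_injective (by simpa using h)

theorem exists_degree_bound (c : FTheta θ × FTheta θ →₀ ℂ) : ∃ k, ∀ x ∈ c.support,
    ∃ s t s' t', HasDegree x.1 s t ∧ HasDegree x.2 s' t' ∧ s ≤ k ∧ t ≤ k ∧ s' ≤ k ∧ t' ≤ k := by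
  choose S T hST using exists_hasDegree (θ := θ)
  refine ⟨∑ x ∈ c.support, (S x.1 + T x.1 + S x.2 + T x.2), fun x hx =>
    ⟨S x.1, T x.1, S x.2, T x.2, hST _, hST _, ?_⟩⟩
  have := Finset.single_le_sum (f := fun x : FTheta θ × FTheta θ =>
    S x.1 + T x.1 + S x.2 + T x.2) (fun _ _ => Nat.zero_le _) hx
  omega

theorem eq_zero_of_mem_of_ne_top [Nontrivial (CStarFTheta.{u} θ)] (hθ : Aperiodic θ)
    {I : TwoSidedIdeal (CStarFTheta.{u} θ)} (hI : I ≠ ⊤) {a : CStarFTheta.{u} θ} (ha : a ∈ I) :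
    a = 0 := by
  refine evalRep_ext fun ρ => ?_
  rw [map_zero, ← ρ.gauge_one]
  change evalGauge ρ 1 a = 0
  ext ξ
  borelize (Circle × Circle)
  let μ : Measure (Circle × Circle) := Measure.haar
  -- Passing to `a* a` makes the averaged function nonnegative, so a zero integral is decisive.
  have hb : star a * a ∈ I := I.mul_mem_left _ _ ha
  have hcont := continuous_inner_evalGauge ρ (star a * a) ξ
  have hint : ∀ x : CStarFTheta.{u} θ, Integrable (fun z => inner ℂ ξ (evalGauge ρ z x ξ)) μ :=
    fun x => (continuous_inner_evalGauge ρ x ξ).integrable_of_hasCompactSupport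
      (HasCompactSupport.of_compactSpace _)
  have hzero : ∫ z, inner ℂ ξ (evalGauge ρ z (star a * a) ξ) ∂μ = 0 := by
    by_contra hne
    have hpos := norm_pos_iff.2 hne
    set J := ∫ z, inner ℂ ξ (evalGauge ρ z (star a * a) ξ) ∂μ with hJ
    set M : ℝ := μ.real Set.univ * ‖ξ‖ ^ 2 with hM
    have hM0 : 0 ≤ M := by positivity
    obtain ⟨c, hc⟩ := exists_finsupp_norm_sub_lt (star a * a)
      (show 0 < ‖J‖ / (2 * M + 1) by positivity)
    obtain ⟨k, hk⟩ := exists_degree_bound c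
    set x : CStarFTheta.{u} θ :=
      ∑ p ∈ c.support, c p • (universalWord θ p.1 * star (universalWord θ p.2)) with hx
    have h1 : ‖∫ z, inner ℂ ξ (evalGauge ρ z x ξ) ∂μ‖ ≤ ‖x - star a * a‖ * M := by
      rw [hx, integral_inner_evalGauge_sum μ ρ hk ξ, norm_mul, Complex.norm_real,
        Real.norm_of_nonneg measureReal_nonneg, hM, mul_left_comm]
      refine mul_le_mul_of_nonneg_left ?_ measureReal_nonneg
      rw [← sum_norm_sq_star ρ k ξ]
      exact norm_sum_mul_inner_le _ _ _ (fun α =>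
        (isStarRep_universalWord θ).norm_sum_invariantCoeff_le hθ hI hb hk α) _
    have h2 : ‖∫ z, inner ℂ ξ (evalGauge ρ z x ξ) ∂μ - J‖ ≤ ‖x - star a * a‖ * M := by
      rw [hJ, ← integral_sub (hint _) (hint _), hM, mul_left_comm, mul_comm]
      refine norm_integral_le_of_norm_le_const (Filter.Eventually.of_forall fun z => ?_)
      rw [← inner_sub_right, ← sub_apply, ← map_sub]
      exact norm_inner_evalGauge_le _ _ _ _
    have h3 : ‖J‖ ≤ ‖∫ z, inner ℂ ξ (evalGauge ρ z x ξ) ∂μ‖ +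
        ‖∫ z, inner ℂ ξ (evalGauge ρ z x ξ) ∂μ - J‖ := by
      rw [norm_sub_rev]
      simpa using norm_add_le (∫ z, inner ℂ ξ (evalGauge ρ z x ξ) ∂μ)
        (J - ∫ z, inner ℂ ξ (evalGauge ρ z x ξ) ∂μ)
    rw [lt_div_iff₀ (by positivity)] at hc
    -- Together, `‖J‖ ≤ 2 M ‖x - a* a‖`, while the tolerance `‖J‖ / (2 M + 1)` makes the right side
    -- smaller than `‖J‖`.
    nlinarith [norm_nonneg (x - star a * a)]
  have hsq : ∀ z, inner ℂ ξ (evalGauge ρ z (star a * a) ξ) =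
      ((‖evalGauge ρ z a ξ‖ ^ 2 : ℝ) : ℂ) := by
    intro z
    rw [map_mul, map_star, mul_apply_eq_comp, ContinuousLinearMap.star_eq_adjoint,
      ContinuousLinearMap.adjoint_inner_right, inner_self_eq_norm_sq_to_K]
    simp
  simp only [hsq] at hzero hcont
  have hcont' : Continuous fun z => ‖evalGauge ρ z a ξ‖ ^ 2 := by
    exact Complex.continuous_re.comp hcont
  -- Haar measure charges every nonempty open set, so a continuous function vanishing almost
  -- everywhere vanishes everywhere, in particular at the untwisted point `1`.
  rw [integral_complex_ofReal, Complex.ofReal_eq_zero,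
    integral_eq_zero_iff_of_nonneg (fun z => by positivity)
      (hcont'.integrable_of_hasCompactSupport (HasCompactSupport.of_compactSpace _)),
    hcont'.ae_eq_iff_eq μ continuous_zero] at hzero
  simpa using congrFun hzero 1

end Integration


/-! ### A concrete representation on infinite paths -/

section Existence

variable {X : Type*}

theorem memℓp_extend {g : X → X} (hg : g.Injective) (h : lp (fun _ : X => ℂ) 2) :
    Memℓp (E := fun _ : X => ℂ) (Function.extend g h 0) 2 := by
  refine memℓp_gen ?_
  have h1 := (lp.memℓp h).summable (by norm_num)
  refine (hg.summable_iff fun y hy => ?_).1 ?_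
  · rw [Function.extend_apply' _ _ _ (by simpa using hy)]
    simp
  · refine h1.congr fun x => ?_
    rw [Function.comp_apply, hg.extend_apply]

/-- The isometry of `ℓ²(X)` that sends the basis vector at `x` to the one at `g x`. -/
noncomputable def lpShift {g : X → X} (hg : g.Injective) :
    lp (fun _ : X => ℂ) 2 →ₗᵢ[ℂ] lp (fun _ : X => ℂ) 2 where
  toFun h := ⟨Function.extend g h 0, memℓp_extend hg h⟩
  map_add' h h' := by
    refine lp.ext (funext fun y => ?_)
    change Function.extend g (⇑h + ⇑h') 0 y = Function.extend g h 0 y + Function.extend g h' 0 y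
    by_cases hy : ∃ x, g x = y
    · obtain ⟨x, rfl⟩ := hy
      simp [hg.extend_apply]
    · simp [Function.extend_apply' _ _ _ hy]
  map_smul' c h := by
    refine lp.ext (funext fun y => ?_)
    change Function.extend g (c • ⇑h) 0 y = c • Function.extend g h 0 y
    by_cases hy : ∃ x, g x = y
    · obtain ⟨x, rfl⟩ := hy
      simp [hg.extend_apply]
    · simp [Function.extend_apply' _ _ _ hy]
  norm_map' h := by
    have h2 : (0 : ℝ) < (2 : ℝ≥0∞).toReal := by norm_num
    refine (Real.rpow_left_inj (norm_nonneg _) (norm_nonneg _) h2.ne').1 ?_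
    rw [lp.norm_rpow_eq_tsum h2, lp.norm_rpow_eq_tsum h2]
    change ∑' y, ‖Function.extend g h 0 y‖ ^ (2 : ℝ≥0∞).toReal = _
    rw [← hg.tsum_eq]
    · exact tsum_congr fun x => by rw [hg.extend_apply]
    · intro y hy
      by_contra hy'
      exact hy (by dsimp only; rw [Function.extend_apply' _ _ _ (by simpa using hy')]; simp)

/-- The bounded operator underlying `lpShift`. -/
noncomputable def lpShiftCLM {g : X → X} (hg : g.Injective) :
    lp (fun _ : X => ℂ) 2 →L[ℂ] lp (fun _ : X => ℂ) 2 :=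
  (lpShift hg).toContinuousLinearMap

theorem lpShiftCLM_apply {g : X → X} (hg : g.Injective) (h : lp (fun _ : X => ℂ) 2) (y : X) :
    lpShiftCLM hg h y = Function.extend g h 0 y := rfl

theorem lpShiftCLM_single [DecidableEq X] {g : X → X} (hg : g.Injective) (x : X) :
    lpShiftCLM hg (lp.single 2 x 1) = lp.single 2 (g x) 1 := by
  refine lp.ext (funext fun y => ?_)
  rw [lpShiftCLM_apply]
  by_cases hy : ∃ x, g x = y
  · obtain ⟨x', rfl⟩ := hy
    rw [hg.extend_apply]
    simp [Pi.single_apply, hg.eq_iff]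
  · rw [Function.extend_apply' _ _ _ hy]
    have : y ≠ g x := fun h => hy ⟨x, h.symm⟩
    simp [this]

theorem star_lpShiftCLM_apply {g : X → X} (hg : g.Injective) (h : lp (fun _ : X => ℂ) 2)
    (x : X) : star (lpShiftCLM hg) h x = h (g x) := by
  classical
  have h1 := ContinuousLinearMap.adjoint_inner_right (lpShiftCLM hg)
    (lp.single 2 x (1 : ℂ) : lp (fun _ : X => ℂ) 2) h
  rw [lpShiftCLM_single, lp.inner_single_left, lp.inner_single_left] at h1
  rw [ContinuousLinearMap.star_eq_adjoint]
  simpa using h1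

/-- Adjoints are compared because they act by plain precomposition. -/
theorem lpShiftCLM_mul {g g' : X → X} (hg : g.Injective) (hg' : g'.Injective) :
    lpShiftCLM hg * lpShiftCLM hg' = lpShiftCLM (hg.comp hg') := by
  refine star_injective (ContinuousLinearMap.ext fun h => lp.ext (funext fun x => ?_))
  rw [star_mul, mul_apply_eq_comp]
  simp only [star_lpShiftCLM_apply, Function.comp_apply]

theorem star_lpShiftCLM_mul {ι : Type*} [DecidableEq ι] {g : ι → X → X}
    (hg : (fun p : ι × X => g p.1 p.2).Injective) (hg' : ∀ i, (g i).Injective) (i k : ι) :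
    star (lpShiftCLM (hg' i)) * lpShiftCLM (hg' k) = if i = k then 1 else 0 := by
  refine ContinuousLinearMap.ext fun h => lp.ext (funext fun x => ?_)
  rw [mul_apply_eq_comp, star_lpShiftCLM_apply, lpShiftCLM_apply]
  split_ifs with hik
  · subst hik
    rw [(hg' i).extend_apply]; rfl
  · rw [Function.extend_apply']
    · rfl
    · rintro ⟨x', hx'⟩
      exact hik (congrArg Prod.fst (@hg (k, x') (i, x) hx')).symm

theorem sum_lpShiftCLM_mul_star {ι : Type*} [Fintype ι] {g : ι → X → X}
    (hg : (fun p : ι × X => g p.1 p.2).Bijective) (hg' : ∀ i, (g i).Injective) :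
    ∑ i, lpShiftCLM (hg' i) * star (lpShiftCLM (hg' i)) = 1 := by
  refine ContinuousLinearMap.ext fun h => lp.ext (funext fun y => ?_)
  obtain ⟨⟨i, x⟩, rfl⟩ := hg.2 y
  rw [sum_apply, lp.coeFn_sum, Finset.sum_apply, Finset.sum_eq_single i]
  · rw [mul_apply_eq_comp, lpShiftCLM_apply]
    dsimp only
    rw [(hg' i).extend_apply, star_lpShiftCLM_apply]
    rfl
  · intro k _ hki
    rw [mul_apply_eq_comp, lpShiftCLM_apply, Function.extend_apply']
    · rfl
    · rintro ⟨x', hx'⟩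
      exact hki (congrArg Prod.fst (@hg.1 (k, x') (i, x) hx'))
  · simp

variable {m n : ℕ}

/-- The infinite path `e_i x`, where `x` stands for `e_{x_0.1} f_{x_0.2} e_{x_1.1} f_{x_1.2} ⋯`. -/
def pathE (θ : Equiv.Perm (Fin m × Fin n)) (i : Fin m) (x : ℕ → Fin m × Fin n) :
    ℕ → Fin m × Fin n
  | 0 => (i, (θ (x 0)).2)
  | k + 1 => ((θ (x k)).1, (θ (x (k + 1))).2)

/-- The infinite path `f_j x`, where `x` stands for `e_{x_0.1} f_{x_0.2} e_{x_1.1} f_{x_1.2} ⋯`. -/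
def pathF (θ : Equiv.Perm (Fin m × Fin n)) (j : Fin n) (x : ℕ → Fin m × Fin n) :
    ℕ → Fin m × Fin n
  | 0 => θ.symm ((x 0).1, j)
  | k + 1 => θ.symm ((x (k + 1)).1, (x k).2)

/-- The leading `e` is read off, and `θ.symm` turns each remaining block `f e` back into `e f`. -/
theorem pathE_bijective (θ : Equiv.Perm (Fin m × Fin n)) :
    (fun p : Fin m × (ℕ → Fin m × Fin n) => pathE θ p.1 p.2).Bijective := by
  refine Function.bijective_iff_has_inverse.2
    ⟨fun y => ((y 0).1, fun k => θ.symm ((y (k + 1)).1, (y k).2)), ?_, ?_⟩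
  · rintro ⟨i, x⟩
    refine Prod.ext rfl (funext fun k => ?_)
    rw [Equiv.symm_apply_eq]
    cases k <;> rfl
  · intro y
    funext k
    cases k <;> simp [pathE]

/-- Swapping every block `e f` by `θ` exposes the leading `f`; the rest regroups into blocks `e f`.
-/
theorem pathF_bijective (θ : Equiv.Perm (Fin m × Fin n)) :
    (fun p : Fin n × (ℕ → Fin m × Fin n) => pathF θ p.1 p.2).Bijective := by
  refine Function.bijective_iff_has_inverse.2
    ⟨fun y => ((θ (y 0)).2, fun k => ((θ (y k)).1, (θ (y (k + 1))).2)), ?_, ?_⟩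
  · rintro ⟨j, x⟩
    refine Prod.ext (by simp [pathF]) (funext fun k => ?_)
    cases k <;> simp [pathF]
  · intro y
    funext k
    cases k <;> simp [pathF]

theorem pathE_pathF (θ : Equiv.Perm (Fin m × Fin n)) (i : Fin m) (j : Fin n)
    (x : ℕ → Fin m × Fin n) :
    pathE θ i (pathF θ j x) = pathF θ (θ (i, j)).2 (pathE θ (θ (i, j)).1 x) := by
  funext k
  rcases k with _ | _ | k <;> simp [pathE, pathF]

/-- Each infinite path starts with exactly one `e_i` and also with exactly one `f_j`, so both
families of shifts on `ℓ²` of the paths are Cuntz families; the commutation relations hold already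
on paths. -/
theorem nonempty_starRep (θ : Equiv.Perm (Fin m × Fin n)) [Nonempty (Fin m × Fin n)] :
    Nonempty (StarRep.{u} θ) := by
  -- The lift places the Hilbert space in the universe of the representations.
  let X : Type u := ULift.{u} (ℕ → Fin m × Fin n)
  let E : Fin m → X → X := fun i x => ⟨pathE θ i x.down⟩
  let F : Fin n → X → X := fun j x => ⟨pathF θ j x.down⟩
  have hE : (fun p : Fin m × X => E p.1 p.2).Bijective :=
    Equiv.ulift.symm.bijective.comp ((pathE_bijective θ).comp
      ((Equiv.refl (Fin m)).prodCongr Equiv.ulift).bijective)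
  have hF : (fun p : Fin n × X => F p.1 p.2).Bijective :=
    Equiv.ulift.symm.bijective.comp ((pathF_bijective θ).comp
      ((Equiv.refl (Fin n)).prodCongr Equiv.ulift).bijective)
  have hE' : ∀ i, (E i).Injective := fun i x y h =>
    congrArg Prod.snd (@hE.1 (i, x) (i, y) h)
  have hF' : ∀ j, (F j).Injective := fun j x y h =>
    congrArg Prod.snd (@hF.1 (j, x) (j, y) h)
  have : Nontrivial (lp (fun _ : X => ℂ) 2) := by
    classical
    obtain ⟨x⟩ : Nonempty X := inferInstance
    refine ⟨lp.single 2 x 1, 0, fun h => ?_⟩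
    have h1 := congrArg (fun v : lp (fun _ : X => ℂ) 2 => v x) h
    simp at h1
  refine ⟨{
    H := lp (fun _ : X => ℂ) 2
    σ := PresentedMonoid.lift
      (Sum.elim (fun i => lpShiftCLM (hE' i)) fun j => lpShiftCLM (hF' j)) ?_
    isometric_e := star_lpShiftCLM_mul hE.1 hE'
    isometric_f := star_lpShiftCLM_mul hF.1 hF'
    defectFree_e := sum_lpShiftCLM_mul_star hE hE'
    defectFree_f := sum_lpShiftCLM_mul_star hF hF' }⟩
  rintro _ _ ⟨i, j⟩
  rw [map_mul, map_mul]
  change lpShiftCLM (hE' i) * lpShiftCLM (hF' j) = lpShiftCLM (hF' _) * lpShiftCLM (hE' _)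
  rw [lpShiftCLM_mul, lpShiftCLM_mul]
  congr 1
  funext x
  exact congrArg ULift.up (pathE_pathF θ i j x.down)

end Existence

end RankTwo

theorem mainTheorem5 {m n : ℕ} (θ : Equiv.Perm (Fin m × Fin n))
    (hθ : RankTwo.Aperiodic θ) :
    RankTwo.IsSimpleCStarAlgebra (RankTwo.CStarFTheta.{u} θ) := by
  obtain ⟨τ, -⟩ := id hθ
  -- The mere existence of a tail gives `m, n ≥ 1`.
  have : Nonempty (Fin m × Fin n) := ⟨(τ.i 0, τ.j 0)⟩
  obtain ⟨ρ⟩ := RankTwo.nonempty_starRep.{u} θ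
  have : Nontrivial (RankTwo.CStarFTheta.{u} θ) :=
    ⟨1, 0, fun h => one_ne_zero ((map_one (RankTwo.evalRep ρ)).symm.trans
      ((congrArg (RankTwo.evalRep ρ) h).trans (map_zero _)))⟩
  refine ⟨this, fun I _ => or_iff_not_imp_right.2 fun hI => ?_⟩
  refine le_bot_iff.1 fun a ha => ?_
  rw [TwoSidedIdeal.mem_bot]
  exact RankTwo.eq_zero_of_mem_of_ne_top hθ hI ha
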